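/- Let $r\ge 2$ be an integer and let $\mathbb T$ be the infinite rooted $r$-ary tree (each node has $r$ children). Let $(X_v)_{v\in\mathbb T}$ be i.i.d. Bernoulli random variables with $P(X_v=1)=p=1-P(X_v=0)$, where $0<p<1/r$. A run is a path in $\mathbb T$ directed away from the root of $\mathbb T$; it is open if $X_v=1$ for all its nodes $v$, its length is its number of nodes, and its root is its first node. For $d\ge 0$ let $R_d$ be the length of the longest open run whose root has generation (distance to the root of $\mathbb T$) at most $d$, with $R_d=0$ if there is none. Let $\nu_d=\dfrac{d}{\log_r(1/p)-1}$, and let $[x]$ denote the largest integer not exceeding $x$. Then, with probability one, $R_d$ is finite for all $d$ and $$\frac{R_d}{d}\to\frac{1}{\log_r(1/p)-1}\qquad\text{as } d\to\infty .$$ The sequence $(R_d-\nu_d)_{d\ge 0}$ is tight. Moreover, the limit $$C=\frac{1-p}{p(r-1)}\,\lim_{h\to\infty}\frac{P(R_0>h)}{(rp)^{h}}$$ exists and is a positive real number depending only on $(p,r)$, and if $Z$ is a random variable with $P(Z\le z)=\exp(-C\,(rp)^{z})$ for all $z\in\mathbb R$, then the following holds. A subsequence of $(R_d-\nu_d)$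 converges weakly if and only if, along this subsequence, $\nu_d$ converges modulo $1$ (that is, in $\mathbb R/\mathbb Z$) to some $a\in\mathbb R$, in which case the weak limit is the law of $[Z+a]-a$ (which depends only on $a$ modulo $1$). In particular, if the fractional parts $\nu_d-[\nu_d]$ converge to $a$ along the subsequence, then the weak limit exists and is the law of $[Z+a]-a$. -/

import Mathlib

open MeasureTheory ProbabilityTheory Filter Topology

namespace TreePercolation

/-- The nodes of the infinite rooted `r`-ary tree: a node is the list of the choices made on the way
from the root `[]` to it, the most recent choice first. -/
abbrev Node (r : ℕ) := List (Fin r)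

/-- The generation of a node: its distance to the root. -/
def gen {r : ℕ} (v : Node r) : ℕ := v.length

/-- `IsParent u v`: the node `v` is one of the `r` children of the node `u`. -/
def IsParent {r : ℕ} (u v : Node r) : Prop := ∃ i : Fin r, v = i :: u

/-- A (finite) run: a nonempty path in the tree directed away from the root of the tree, with first
node `root`, every later node being a child of the preceding one. -/
structure Run (r : ℕ) where
  /-- the node of smallest generation of the run -/
  root : Node r
  /-- the other nodes of the run, in order -/
  tail : List (Node r)
  isChain : (root :: tail).IsChain IsParent

/-- The nodes of a run. -/
def Run.nodes {r : ℕ} (A : Run r) : List (Node r) := A.root :: A.tail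

/-- The number of nodes of a run. -/
def Run.size {r : ℕ} (A : Run r) : ℕ := A.nodes.length

/-- A run is open in the configuration `x` if all its nodes have the value `1`. -/
def Run.IsOpen {r : ℕ} (A : Run r) (x : Node r → ℕ) : Prop := ∀ v ∈ A.nodes, x v = 1

/-- `R_d`: the length (number of nodes) of the longest open run whose root has generation at most
`d`. It is `0` if there is no such run, and `⊤` if there are such runs of arbitrarily large length
(in particular if there is an infinite one, whose initial segments are finite runs). -/
noncomputable def longestRun {r : ℕ} (d : ℕ) (x : Node r → ℕ) : ℕ∞ :=
  ⨆ (A : Run r) (_ : gen A.root ≤ d ∧ A.IsOpen x), (A.size : ℕ∞)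

/-- The family `X` of random variables is a Bernoulli percolation with parameter `p` on the `r`-ary
tree: the variables are independent and take the values `1` and `0` with probabilities `p` and
`1 - p`. -/
structure IsBernoulliPercolation {Ω : Type*} [MeasurableSpace Ω] (μ : Measure Ω) (r : ℕ) (p : ℝ)
    (X : Node r → Ω → ℕ) : Prop where
  measurable : ∀ v, Measurable (X v)
  indep : iIndepFun X μ
  prob_one : ∀ v, μ.real {ω | X v ω = 1} = p
  prob_zero : ∀ v, μ.real {ω | X v ω = 0} = 1 - p

/-- The random variable `R_d`. -/
noncomputable def R {Ω : Type*} {r : ℕ} (X : Node r → Ω → ℕ) (d : ℕ) (ω : Ω) : ℕ∞ :=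
  longestRun d (fun v => X v ω)

/-- The centering sequence `ν_d = d / (log_r (1 / p) - 1)`. -/
noncomputable def nu (r : ℕ) (p : ℝ) (d : ℕ) : ℝ := d / (Real.logb r (1 / p) - 1)

/-- The centered real random variable `R_d - ν_d` (to be used when `R_d` is almost surely finite). -/
noncomputable def centered {Ω : Type*} {r : ℕ} (p : ℝ) (X : Node r → Ω → ℕ) (d : ℕ) (ω : Ω) : ℝ :=
  ((R X d ω).toNat : ℝ) - nu r p d

end TreePercolation

/-! Put x = rp < 1. The probability q_n of an open path of n + 1 nodes from a given node satisfies
q_{n+1} = p(1 - (1 - q_n)^r), hence q_n ~ c x^n with c > 0 (`exists_tendsto_survival`).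
Heuristically, the runs of more than m nodes that start below a closed parent and have root in
generation at most d form a nearly Poisson number with mean Λ r^d x^m, where Λ = c(1 - p)r/(r - 1).

The proof makes this exact by a recursion on d. Splitting on the state of the root, P(R_d ≤ m)
satisfies a closed recursion once it is refined by a second bound j on the runs from the root: this
is `jointCdf`, identified in `real_shortRuns`. Taking logarithms turns the recursion into a sum over
generations, and dominated convergence gives -log P(R_d ≤ m) ~ Λ r^d x^m as d and m tend to infinity
jointly (`tendsto_neg_log_jointCdf`).

Since x^(-ν_d) = r^d, this reads P(R_d - ν_d ≤ y) ≈ exp(-Λ x^e) with e = [y + ν_d] - ν_d, which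
depends on ν_d only modulo 1. This yields the weak limits, with C = Λ/x. The same estimate gives
exponential tails uniform in large d (`exists_real_abs_centered_gt_le`), hence tightness and, by
Borel–Cantelli, the almost sure limit. Conversely, R_d is an integer, so the characteristic function
of R_d - ν_d at -2π is exactly exp(2πi ν_d); weak convergence therefore forces ν_d to converge
modulo 1 (`exists_tendsto_nu`). -/

namespace TreePercolation

/-! ### Recursions for the survival probabilities and the distribution functions, and their
asymptotics. -/

section Analysis

/-- The probability that there is an open path of `n + 1` nodes starting at the root. -/
noncomputable def survival (r : ℕ) (p : ℝ) : ℕ → ℝ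
  | 0 => p
  | n + 1 => p * (1 - (1 - survival r p n) ^ r)

/-- The probability that no open run of more than `m` nodes starts in the generations up to `d`
and that no open run of more than `j` nodes starts at the root, for `j ≤ m`. -/
noncomputable def jointCdf (r : ℕ) (p : ℝ) (m : ℕ) : ℕ → ℕ → ℝ
  | 0, j => 1 - survival r p j
  | d + 1, 0 => (1 - p) * jointCdf r p m d m ^ r
  | d + 1, j + 1 => (1 - p) * jointCdf r p m d m ^ r + p * jointCdf r p m d j ^ r

/-- The conditional probability that an open run of more than `j` nodes starts at the root, given
that no open run of more than `m` nodes starts in the generations up to `d`. -/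
noncomputable def condSurvival (r : ℕ) (p : ℝ) (m d j : ℕ) : ℝ :=
  1 - jointCdf r p m d j / jointCdf r p m d m

variable {r : ℕ} {p : ℝ}

lemma one_sub_one_sub_pow (r : ℕ) (s : ℝ) :
    1 - (1 - s) ^ r = s * ∑ i ∈ Finset.range r, (1 - s) ^ i := by
  have := mul_neg_geom_sum (1 - s) r
  linarith [this]

lemma one_sub_one_sub_pow_le {s : ℝ} (hs : s ≤ 1) (r : ℕ) : 1 - (1 - s) ^ r ≤ r * s := by
  have := one_add_mul_le_pow (a := -s) (by linarith) r
  rw [← sub_eq_add_neg] at this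
  linarith

/-- Bernoulli's inequality in the form (1 - s)^r ≤ (1 + s)^(-r) ≤ 1/(1 + rs). The linear fractional
bound is chosen because its iterates can be computed exactly. -/
lemma le_one_sub_one_sub_pow {s : ℝ} (hs0 : 0 ≤ s) (hs : s ≤ 1) (r : ℕ) :
    r * s / (1 + r * s) ≤ 1 - (1 - s) ^ r := by
  have h1 : 0 < 1 + r * s := by positivity
  have h2 := one_add_mul_le_pow (a := s) (by linarith) r
  have h3 : (1 - s) ^ r * (1 + s) ^ r ≤ 1 := by
    rw [← mul_pow]
    exact pow_le_one₀ (by nlinarith) (by nlinarith)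
  have h4 : 0 ≤ (1 - s) ^ r := pow_nonneg (by linarith) r
  rw [div_le_iff₀ h1]
  nlinarith [mul_le_mul_of_nonneg_left h2 h4]

lemma survival_mem (hr : 2 ≤ r) (hp0 : 0 < p) (hp : r * p < 1) (n : ℕ) :
    0 < survival r p n ∧ survival r p n ≤ p ∧ survival r p (n + 1) ≤ r * p * survival r p n := by
  have hr' : (2 : ℝ) ≤ r := by exact_mod_cast hr
  have hp1 : p < 1 := by nlinarith
  have key : ∀ s : ℝ, 0 < s → s ≤ p → p * (1 - (1 - s) ^ r) ≤ r * p * s := fun s h1 h2 ↦ by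
    nlinarith [one_sub_one_sub_pow_le (s := s) (by linarith) r]
  induction n with
  | zero => exact ⟨hp0, le_rfl, key p hp0 le_rfl⟩
  | succ n ih =>
    obtain ⟨h1, h2, h3⟩ := ih
    have h4 : survival r p (n + 1) ≤ p := h3.trans (by nlinarith)
    have h5 : 0 < survival r p (n + 1) :=
      mul_pos hp0 (sub_pos.2 (pow_lt_one₀ (by linarith) (by linarith) (by lia)))
    exact ⟨h5, h4, key _ h5 h4⟩

lemma survival_antitone (hr : 2 ≤ r) (hp0 : 0 < p) (hp : r * p < 1) : Antitone (survival r p) :=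
  antitone_nat_of_succ_le fun n ↦ by
    obtain ⟨h1, h2, h3⟩ := survival_mem hr hp0 hp n
    nlinarith

lemma survival_le_pow (hr : 2 ≤ r) (hp0 : 0 < p) (hp : r * p < 1) (n : ℕ) :
    survival r p n ≤ p * (r * p) ^ n := by
  induction n with
  | zero => simp [survival]
  | succ n ih =>
    refine (survival_mem hr hp0 hp n).2.2.trans ?_
    rw [pow_succ]
    nlinarith [mul_le_mul_of_nonneg_left ih (show 0 ≤ (r : ℝ) * p by positivity)]

/-- The left side is the exact solution of b_{n+1} = rp b_n / (1 + r b_n), b_0 = p, a recursion that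
`le_one_sub_one_sub_pow` places below that of `survival`. It keeps the limit of `survival r p n / (r
* p) ^ n` away from 0. -/
lemma le_survival (hr : 2 ≤ r) (hp0 : 0 < p) (hp : r * p < 1) (n : ℕ) :
    p * (1 - r * p) * (r * p) ^ n / (1 - (r * p) ^ (n + 1)) ≤ survival r p n := by
  have hx0 : 0 < (r : ℝ) * p := by positivity
  have hpos : ∀ n : ℕ, 0 < 1 - ((r : ℝ) * p) ^ (n + 1) := fun n ↦
    sub_pos.2 (pow_lt_one₀ hx0.le hp (by lia))
  induction n with
  | zero => rw [div_le_iff₀ (hpos 0)]; simp [survival]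
  | succ n ih =>
    obtain ⟨h1, h2, -⟩ := survival_mem hr hp0 hp n
    have hr' : (2 : ℝ) ≤ r := by exact_mod_cast hr
    have h3 := le_one_sub_one_sub_pow h1.le (by nlinarith) r
    rw [div_le_iff₀ (hpos n)] at ih
    rw [div_le_iff₀ (hpos _)]
    have h4 : (0 : ℝ) < 1 + r * survival r p n := by positivity
    have h5 : p * (r * survival r p n / (1 + r * survival r p n)) ≤ survival r p (n + 1) :=
      mul_le_mul_of_nonneg_left h3 hp0.le
    refine le_trans ?_ (mul_le_mul_of_nonneg_right h5 (hpos _).le)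
    rw [← mul_div_assoc, div_mul_eq_mul_div, le_div_iff₀ h4]
    set q := survival r p n
    set x := (r : ℝ) * p with hx
    have e1 : p * (r * q) = x * q := by rw [hx]; ring
    have e2 : p * (1 - x) * x ^ (n + 1) * (1 + r * q)
        = x * (p * (1 - x) * x ^ n) + x * q * ((1 - x) * x ^ (n + 1)) := by
      rw [hx]; ring
    rw [e1, e2]
    have e3 := mul_le_mul_of_nonneg_left ih hx0.le
    have e4 : x * q * (1 - x ^ (n + 1 + 1)) =
      x * (q * (1 - x ^ (n + 1))) + x * q * ((1 - x) * x ^ (n + 1)) := by ring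
    linarith

/-- The survival probability decays exactly like `(r p) ^ n`. -/
lemma exists_tendsto_survival (hr : 2 ≤ r) (hp0 : 0 < p) (hp : r * p < 1) :
    ∃ c, 0 < c ∧ Tendsto (fun n ↦ survival r p n / (r * p) ^ n) atTop (𝓝 c) := by
  have hx0 : 0 < (r : ℝ) * p := by positivity
  have hlow : ∀ n, p * (1 - r * p) ≤ survival r p n / (r * p) ^ n := fun n ↦ by
    rw [le_div_iff₀ (by positivity)]
    have hx1 : 0 < ((r : ℝ) * p) ^ (n + 1) := by positivity
    have hx2 : ((r : ℝ) * p) ^ (n + 1) < 1 := pow_lt_one₀ hx0.le hp (by lia)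
    refine le_trans ?_ (le_survival hr hp0 hp n)
    have : 0 < 1 - (r : ℝ) * p := by linarith
    exact le_div_self (by positivity) (by linarith) (by linarith)
  -- The ratio decreases by the upper bound q_{n+1} ≤ rp q_n, so it converges to its infimum.
  have hanti : Antitone fun n ↦ survival r p n / (r * p) ^ n :=
    antitone_nat_of_succ_le fun n ↦ by
      rw [div_le_div_iff₀ (by positivity) (by positivity), pow_succ]
      nlinarith [mul_le_mul_of_nonneg_right (survival_mem hr hp0 hp n).2.2
        (show 0 ≤ ((r : ℝ) * p) ^ n by positivity)]
  have hbdd : BddBelow (Set.range fun n ↦ survival r p n / (r * p) ^ n) :=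
    ⟨p * (1 - r * p), by rintro _ ⟨n, rfl⟩; exact hlow n⟩
  refine ⟨_, ?_, tendsto_atTop_ciInf hanti hbdd⟩
  exact lt_of_lt_of_le (mul_pos hp0 (by linarith)) (le_ciInf hlow)

lemma jointCdf_pos_and_mono (hr : 2 ≤ r) (hp0 : 0 < p) (hp : r * p < 1) (m d : ℕ) :
    (∀ j, 0 < jointCdf r p m d j) ∧ Monotone (jointCdf r p m d) := by
  have hr' : (2 : ℝ) ≤ r := by exact_mod_cast hr
  have hp1 : 0 < 1 - p := by nlinarith
  induction d with
  | zero =>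
    refine ⟨fun j ↦ ?_, fun i j h ↦ ?_⟩
    · have := (survival_mem hr hp0 hp j).2.1
      simp only [jointCdf]; linarith
    · have := survival_antitone hr hp0 hp h
      simp only [jointCdf]; linarith
  | succ d ih =>
    obtain ⟨h1, h2⟩ := ih
    have hA : 0 < (1 - p) * jointCdf r p m d m ^ r := mul_pos hp1 (pow_pos (h1 m) r)
    have hB : ∀ j, 0 < p * jointCdf r p m d j ^ r := fun j ↦ mul_pos hp0 (pow_pos (h1 j) r)
    refine ⟨fun j ↦ ?_, monotone_nat_of_le_succ fun j ↦ ?_⟩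
    · cases j with
      | zero => exact hA
      | succ j => exact add_pos hA (hB j)
    · cases j with
      | zero => exact le_add_of_nonneg_right (hB 0).le
      | succ j =>
        have := pow_le_pow_left₀ (h1 j).le (h2 j.le_succ) r
        have := mul_le_mul_of_nonneg_left this hp0.le
        simp only [jointCdf]
        linarith

lemma condSurvival_nonneg (hr : 2 ≤ r) (hp0 : 0 < p) (hp : r * p < 1) {m j : ℕ} (d : ℕ)
    (hj : j ≤ m) : 0 ≤ condSurvival r p m d j := by
  obtain ⟨h1, h2⟩ := jointCdf_pos_and_mono hr hp0 hp m d
  exact sub_nonneg.2 ((div_le_one (h1 m)).2 (h2 hj))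

lemma condSurvival_lt_one (hr : 2 ≤ r) (hp0 : 0 < p) (hp : r * p < 1) (m d j : ℕ) :
    condSurvival r p m d j < 1 := by
  obtain ⟨h1, h2⟩ := jointCdf_pos_and_mono hr hp0 hp m d
  exact sub_lt_self _ (div_pos (h1 j) (h1 m))

lemma jointCdf_eq (hr : 2 ≤ r) (hp0 : 0 < p) (hp : r * p < 1) (m d j : ℕ) :
    jointCdf r p m d j = jointCdf r p m d m * (1 - condSurvival r p m d j) := by
  have h1 := (jointCdf_pos_and_mono hr hp0 hp m d).1 m
  rw [condSurvival]; field_simp; ring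

lemma jointCdf_succ_succ (hr : 2 ≤ r) (hp0 : 0 < p) (hp : r * p < 1) (m d j : ℕ) :
    jointCdf r p m (d + 1) (j + 1) =
      jointCdf r p m d m ^ r * (1 - p * (1 - (1 - condSurvival r p m d j) ^ r)) := by
  rw [jointCdf, jointCdf_eq hr hp0 hp m d j, mul_pow]; ring

lemma runs_factor_pos (hr : 2 ≤ r) (hp0 : 0 < p) (hp : r * p < 1) (m d j : ℕ) :
    0 < 1 - p * (1 - (1 - condSurvival r p m d j) ^ r) := by
  have h1 := (jointCdf_pos_and_mono hr hp0 hp m d).1 m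
  have h2 := (jointCdf_pos_and_mono hr hp0 hp m (d + 1)).1 (j + 1)
  rw [jointCdf_succ_succ hr hp0 hp] at h2
  exact pos_of_mul_pos_right h2 (by positivity)

/-- The common factor `jointCdf r p (m + 1) d (m + 1) ^ r` cancels in the quotient, leaving a
recursion for the conditional probabilities alone. The index `m` appears because an open root uses
up one node of the allowed length `m + 1`. -/
lemma condSurvival_succ_succ (hr : 2 ≤ r) (hp0 : 0 < p) (hp : r * p < 1) (m d j : ℕ) :
    condSurvival r p (m + 1) (d + 1) (j + 1) =
      p * ((1 - (1 - condSurvival r p (m + 1) d j) ^ r)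
        - (1 - (1 - condSurvival r p (m + 1) d m) ^ r))
        / (1 - p * (1 - (1 - condSurvival r p (m + 1) d m) ^ r)) := by
  have h1 := (jointCdf_pos_and_mono hr hp0 hp (m + 1) d).1 (m + 1)
  have h2 := runs_factor_pos hr hp0 hp (m + 1) d m
  rw [condSurvival, jointCdf_succ_succ hr hp0 hp, jointCdf_succ_succ hr hp0 hp,
    mul_div_mul_left _ _ (by positivity), eq_div_iff h2.ne', sub_mul, div_mul_cancel₀ _ h2.ne']
  ring

lemma condSurvival_le_iff (hr : 2 ≤ r) (hp0 : 0 < p) (hp : r * p < 1) (m d j : ℕ) (q : ℝ) :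
    condSurvival r p m d j ≤ q ↔ (1 - q) * jointCdf r p m d m ≤ jointCdf r p m d j := by
  have h1 := (jointCdf_pos_and_mono hr hp0 hp m d).1 m
  rw [condSurvival, sub_le_comm, le_div_iff₀ h1]

/-- Positive correlation: forbidding long runs elsewhere can only make a run from the root less
likely. In the recursion it follows from the monotonicity of 1 - (1 - s)^r in s. It supplies a bound
uniform in `d`. -/
lemma condSurvival_le (hr : 2 ≤ r) (hp0 : 0 < p) (hp : r * p < 1) {m d j : ℕ} (hj : j ≤ m) :
    condSurvival r p m d j ≤ survival r p j := by
  have hr' : (2 : ℝ) ≤ r := by exact_mod_cast hr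
  have hp1 : 0 < 1 - p := by nlinarith
  induction d generalizing j with
  | zero =>
    have := survival_mem hr hp0 hp m
    have := survival_mem hr hp0 hp j
    rw [condSurvival_le_iff hr hp0 hp]
    simp only [jointCdf]
    nlinarith
  | succ d ih =>
    rw [condSurvival_le_iff hr hp0 hp]
    have h1 := (jointCdf_pos_and_mono hr hp0 hp m d).1 m
    have hpow : ∀ i ≤ m, 0 ≤ (1 - condSurvival r p m d i) ^ r ∧
        (1 - condSurvival r p m d i) ^ r ≤ 1 := fun i hi ↦ by
      have a1 := condSurvival_nonneg hr hp0 hp d hi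
      have a2 := condSurvival_lt_one hr hp0 hp m d i
      exact ⟨pow_nonneg (by linarith) r, pow_le_one₀ (by linarith) (by linarith)⟩
    have htop : jointCdf r p m (d + 1) m ≤ jointCdf r p m d m ^ r := by
      cases m with
      | zero => exact mul_le_of_le_one_left (by positivity) (by linarith)
      | succ m =>
        rw [jointCdf_succ_succ hr hp0 hp]
        have := hpow m (by lia)
        exact mul_le_of_le_one_right (by positivity) (by nlinarith)
    cases j with
    | zero => exact mul_le_mul_of_nonneg_left htop (by simp [survival, hp1.le])
    | succ j =>
      have ih' := ih (j := j) (by lia)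
      have hq := (survival_mem hr hp0 hp j).2.1
      have hq' := (survival_mem hr hp0 hp (j + 1)).2.1
      rw [jointCdf_succ_succ hr hp0 hp, mul_comm (jointCdf r p m d m ^ r)]
      refine mul_le_mul ?_ htop ((jointCdf_pos_and_mono hr hp0 hp m _).1 m).le
        (runs_factor_pos hr hp0 hp m d j).le
      have := pow_le_pow_left₀ (a := 1 - survival r p j) (b := 1 - condSurvival r p m d j)
        (by linarith) (by linarith) r
      simp only [survival]
      nlinarith

lemma tendsto_zero_of_div_pow {x : ℝ} (hx0 : 0 < x) (hx : x < 1) {s : ℕ → ℝ} {L : ℝ}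
    (h : Tendsto (fun n ↦ s n / x ^ n) atTop (𝓝 L)) : Tendsto s atTop (𝓝 0) := by
  have := h.mul (tendsto_pow_atTop_nhds_zero_of_lt_one hx0.le hx)
  rw [mul_zero] at this
  exact this.congr fun n ↦ div_mul_cancel₀ _ (pow_pos hx0 n).ne'

lemma tendsto_one_sub_one_sub_pow_div {x : ℝ} (hx0 : 0 < x) (hx : x < 1) {s : ℕ → ℝ} {L : ℝ}
    (r : ℕ) (h : Tendsto (fun n ↦ s n / x ^ n) atTop (𝓝 L)) :
    Tendsto (fun n ↦ (1 - (1 - s n) ^ r) / x ^ n) atTop (𝓝 (r * L)) := by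
  have h0 := tendsto_zero_of_div_pow hx0 hx h
  have h1 : Tendsto (fun n ↦ ∑ i ∈ Finset.range r, (1 - s n) ^ i) atTop (𝓝 r) := by
    have : Tendsto (fun n ↦ ∑ i ∈ Finset.range r, (1 - s n) ^ i) atTop
        (𝓝 (∑ i ∈ Finset.range r, (1 - (0 : ℝ)) ^ i)) :=
      tendsto_finsetSum _ fun i _ ↦ (h0.const_sub 1).pow i
    simpa using this
  refine (h1.mul h).congr fun n ↦ ?_
  rw [one_sub_one_sub_pow]; ring

/-- Squeeze between s ≤ -log(1 - s) ≤ s/(1 - s). -/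
lemma tendsto_neg_log_one_sub_div {x : ℝ} (hx0 : 0 < x) (hx : x < 1) {s : ℕ → ℝ} {L : ℝ}
    (h : Tendsto (fun n ↦ s n / x ^ n) atTop (𝓝 L)) :
    Tendsto (fun n ↦ -Real.log (1 - s n) / x ^ n) atTop (𝓝 L) := by
  have h0 := tendsto_zero_of_div_pow hx0 hx h
  have h1 : Tendsto (fun n ↦ s n / x ^ n / (1 - s n)) atTop (𝓝 L) := by
    have := h.div (h0.const_sub 1) (by norm_num)
    rwa [sub_zero, div_one] at this
  have hev : ∀ᶠ n in atTop, s n < 1 := h0.eventually_lt_const one_pos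
  refine tendsto_of_tendsto_of_tendsto_of_le_of_le' h h1 ?_ ?_
  · filter_upwards [hev] with n hn
    have := Real.log_le_sub_one_of_pos (sub_pos.2 hn)
    exact div_le_div_of_nonneg_right (by linarith) (by positivity)
  · filter_upwards [hev] with n hn
    have hs := sub_pos.2 hn
    have := Real.one_sub_inv_le_log_of_pos hs
    rw [div_right_comm]
    refine div_le_div_of_nonneg_right ?_ (by positivity)
    have e : s n / (1 - s n) = (1 - s n)⁻¹ - 1 := by field_simp; ring
    linarith

/-- To first order the condition just removes the runs of more than n + k nodes, leaving q_n -
q_{n+k} whatever `d` is. In the induction the gap k is fed by the gaps k + 1 and 1, and (1 -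
x^(k+1)) - x^k(1 - x) = 1 - x^k with x = rp. -/
lemma tendsto_condSurvival (hr : 2 ≤ r) (hp0 : 0 < p) (hp : r * p < 1) {c : ℝ}
    (hc : Tendsto (fun n ↦ survival r p n / (r * p) ^ n) atTop (𝓝 c)) (d k : ℕ) :
    Tendsto (fun n ↦ condSurvival r p (n + k) d n / (r * p) ^ n) atTop
      (𝓝 (c * (1 - (r * p) ^ k))) := by
  have hx0 : 0 < (r : ℝ) * p := by positivity
  induction d generalizing k with
  | zero =>
    have h1 : Tendsto (fun n ↦ survival r p (n + k) / (r * p) ^ n) atTop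
        (𝓝 (c * (r * p) ^ k)) := by
      refine (((tendsto_add_atTop_iff_nat k).2 hc).mul_const _).congr fun n ↦ ?_
      rw [pow_add]; field_simp
    have h2 := tendsto_zero_of_div_pow hx0 hp h1
    have h3 := (hc.sub h1).div (h2.const_sub 1) (by norm_num)
    rw [sub_zero, div_one, ← mul_one_sub] at h3
    refine h3.congr fun n ↦ ?_
    have hq := (survival_mem hr hp0 hp (n + k)).2.1
    have hr' : (2 : ℝ) ≤ r := by exact_mod_cast hr
    have h4 : 1 - survival r p (n + k) ≠ 0 := by nlinarith
    simp only [condSurvival, jointCdf, Pi.div_apply]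
    field_simp
    ring
  | succ d ih =>
    rw [← tendsto_add_atTop_iff_nat 1]
    have h1 := tendsto_one_sub_one_sub_pow_div hx0 hp r (ih (k + 1))
    have h2 := ((tendsto_add_atTop_iff_nat k).2 (ih 1)).mul_const (((r : ℝ) * p) ^ k)
    have h2' : Tendsto (fun n ↦ condSurvival r p (n + k + 1) d (n + k) / (r * p) ^ n) atTop
        (𝓝 (c * (1 - (r * p) ^ 1) * (r * p) ^ k)) := by
      refine h2.congr fun n ↦ ?_
      rw [pow_add]; field_simp
    have h3 := tendsto_one_sub_one_sub_pow_div hx0 hp r h2'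
    have h4 := tendsto_zero_of_div_pow hx0 hp h3
    have h5 := ((h1.sub h3).mul_const ((r : ℝ)⁻¹)).div ((h4.const_mul p).const_sub 1)
      (by norm_num)
    have hr0 : (r : ℝ) ≠ 0 := by positivity
    have e : (r * (c * (1 - (r * p) ^ (k + 1))) - r * (c * (1 - (r * p) ^ 1) * (r * p) ^ k))
        * (r : ℝ)⁻¹ / (1 - p * 0) = c * (1 - (r * p) ^ k) := by
      rw [pow_succ]; field_simp; ring
    rw [e] at h5
    refine h5.congr fun n ↦ ?_
    have hf := runs_factor_pos hr hp0 hp (n + k + 1) d (n + k)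
    rw [show n + 1 + k = n + k + 1 by ring, condSurvival_succ_succ hr hp0 hp, pow_succ]
    simp only [Pi.div_apply, ← add_assoc]
    field_simp

/-- One generation multiplies -log by r and adds the logarithm of the factor in
`jointCdf_succ_succ`; this is that affine recursion unrolled. -/
lemma neg_log_jointCdf_succ (hr : 2 ≤ r) (hp0 : 0 < p) (hp : r * p < 1) (n d : ℕ) :
    -Real.log (jointCdf r p (n + 1) d (n + 1)) = r ^ d * (-Real.log (1 - survival r p (n + 1)) +
      ∑ i ∈ Finset.range d,
        -Real.log (1 - p * (1 - (1 - condSurvival r p (n + 1) i n) ^ r)) / r ^ (i + 1)) := by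
  have hr0 : (r : ℝ) ≠ 0 := by positivity
  induction d with
  | zero => simp [jointCdf]
  | succ d ih =>
    have h1 := (jointCdf_pos_and_mono hr hp0 hp (n + 1) d).1 (n + 1)
    rw [jointCdf_succ_succ hr hp0 hp, Real.log_mul (by positivity)
      (runs_factor_pos hr hp0 hp (n + 1) d n).ne', Real.log_pow, neg_add, ← mul_neg, ih,
      Finset.sum_range_succ]
    field_simp
    ring

/-- The distribution function of the longest run started in the generations up to `d`, at `m`,
behaves like `exp (-Λ r ^ d (r p) ^ m)` as `d` and `m` tend to infinity. -/
lemma tendsto_neg_log_jointCdf_succ (hr : 2 ≤ r) (hp0 : 0 < p) (hp : r * p < 1) {c : ℝ}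
    (hc : Tendsto (fun n ↦ survival r p n / (r * p) ^ n) atTop (𝓝 c)) :
    Tendsto (fun z : ℕ × ℕ ↦ -Real.log (jointCdf r p (z.2 + 1) z.1 (z.2 + 1)) /
      (r ^ z.1 * (r * p) ^ (z.2 + 1))) (atTop ×ˢ atTop) (𝓝 (c * r * (1 - p) / (r - 1))) := by
  have hx0 : 0 < (r : ℝ) * p := by positivity
  have hr' : (2 : ℝ) ≤ r := by exact_mod_cast hr
  have hr0 : (r : ℝ) ≠ 0 := by positivity
  have hp1 : 0 < 1 - p := by nlinarith
  have hfst : Tendsto (fun n ↦ -Real.log (1 - survival r p (n + 1)) / (r * p) ^ (n + 1)) atTop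
      (𝓝 c) := (tendsto_add_atTop_iff_nat 1).2 (tendsto_neg_log_one_sub_div hx0 hp hc)
  set e : ℕ → ℕ → ℝ := fun n i ↦
    -Real.log (1 - p * (1 - (1 - condSurvival r p (n + 1) i n) ^ r)) with he
  have hlim : ∀ i, Tendsto (fun n ↦ e n i / (r * p) ^ (n + 1)) atTop (𝓝 (c * (1 - r * p))) := by
    intro i
    have h1 := tendsto_one_sub_one_sub_pow_div hx0 hp r (tendsto_condSurvival hr hp0 hp hc i 1)
    have h2 : Tendsto (fun n ↦ p * (1 - (1 - condSurvival r p (n + 1) i n) ^ r) / (r * p) ^ n)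
        atTop (𝓝 (p * (r * (c * (1 - (r * p) ^ 1))))) := by
      simpa only [mul_div_assoc] using h1.const_mul p
    have h3 := (tendsto_neg_log_one_sub_div hx0 hp h2).div_const ((r : ℝ) * p)
    have e1 : p * (r * (c * (1 - (r * p) ^ 1))) / ((r : ℝ) * p) = c * (1 - r * p) := by
      field_simp
    rw [e1] at h3
    refine h3.congr fun n ↦ ?_
    rw [pow_succ, he, div_div]
  -- Domination uniform in both indices, from `condSurvival_le` and `survival_le_pow`.
  have hbd : ∀ n i, 0 ≤ e n i ∧ e n i / (r * p) ^ (n + 1) ≤ p / (1 - p) := by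
    intro n i
    have a0 := condSurvival_nonneg hr hp0 hp i n.le_succ
    have a1 := condSurvival_lt_one hr hp0 hp (n + 1) i n
    have a2 := condSurvival_le hr hp0 hp (d := i) n.le_succ
    have a3 := survival_le_pow hr hp0 hp n
    have a4 := one_sub_one_sub_pow_le a1.le r
    set w := 1 - (1 - condSurvival r p (n + 1) i n) ^ r with hw
    have w0 : 0 ≤ w := sub_nonneg.2 (pow_le_one₀ (by linarith) (by linarith))
    have w1 : w ≤ 1 := sub_le_self _ (pow_nonneg (by linarith) r)
    have hpos : 0 < 1 - p * w := by nlinarith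
    refine ⟨neg_nonneg.2 (Real.log_nonpos hpos.le (by nlinarith)), ?_⟩
    have hlog := Real.one_sub_inv_le_log_of_pos hpos
    have b1 : e n i ≤ (1 - p * w)⁻¹ - 1 := by simp only [he, ← hw]; linarith
    have b2 : (1 - p * w)⁻¹ - 1 ≤ p * w / (1 - p) := by
      rw [show (1 - p * w)⁻¹ - 1 = p * w / (1 - p * w) by field_simp; ring]
      exact div_le_div_of_nonneg_left (by positivity) hp1 (by nlinarith)
    have b3 : p * w ≤ p * (r * p) ^ (n + 1) := by
      have : w ≤ r * (p * (r * p) ^ n) := a4.trans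
        (mul_le_mul_of_nonneg_left (a2.trans a3) (by positivity))
      rw [pow_succ]
      nlinarith
    rw [div_le_iff₀ (by positivity), div_mul_eq_mul_div]
    exact (b1.trans b2).trans (div_le_div_of_nonneg_right b3 hp1.le)
  have hgeom : Summable fun i : ℕ ↦ p / (1 - p) * ((r : ℝ)⁻¹) ^ (i + 1) :=
    (((summable_geometric_of_lt_one (by positivity)
      (inv_lt_one_of_one_lt₀ (by linarith))).mul_left _).comp_injective (add_left_injective 1))
  -- Extending the sum over i < d by zeros makes d a parameter of the summand, so dominated
  -- convergence gives the joint limit in d and m without any relation between them.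
  have hsum : Tendsto (fun z : ℕ × ℕ ↦ ∑' i, if i < z.1 then
      e z.2 i / (r * p) ^ (z.2 + 1) * ((r : ℝ)⁻¹) ^ (i + 1) else 0) (atTop ×ˢ atTop)
      (𝓝 (∑' i : ℕ, c * (1 - r * p) * ((r : ℝ)⁻¹) ^ (i + 1))) := by
    refine tendsto_tsum_of_dominated_convergence hgeom (fun i ↦ ?_) (Eventually.of_forall ?_)
    · refine (((hlim i).comp tendsto_snd).mul_const _).congr' ?_
      filter_upwards [tendsto_fst.eventually (eventually_gt_atTop i)] with z hz
      simp [hz]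
    · intro z i
      obtain ⟨b0, b1⟩ := hbd z.2 i
      have : 0 ≤ e z.2 i / (r * p) ^ (z.2 + 1) := by positivity
      split_ifs
      · rw [Real.norm_of_nonneg (by positivity)]
        gcongr
      · simp only [norm_zero]; positivity
  have hval : c + ∑' i : ℕ, c * (1 - r * p) * ((r : ℝ)⁻¹) ^ (i + 1)
      = c * r * (1 - p) / (r - 1) := by
    simp_rw [pow_succ']
    rw [tsum_mul_left, tsum_mul_left, tsum_geometric_of_lt_one (by positivity)
      (inv_lt_one_of_one_lt₀ (by linarith))]
    have h1 : (r : ℝ) - 1 ≠ 0 := by linarith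
    have h2 : 1 - (r : ℝ)⁻¹ ≠ 0 := by
      rw [show 1 - (r : ℝ)⁻¹ = (r - 1) / r by field_simp]
      exact div_ne_zero h1 hr0
    field_simp
    ring
  rw [← hval]
  refine ((hfst.comp tendsto_snd).add hsum).congr fun z ↦ ?_
  rw [neg_log_jointCdf_succ hr hp0 hp, mul_div_mul_left _ _ (by positivity), add_div,
    Finset.sum_div, Function.comp_apply]
  congr 1
  rw [tsum_eq_sum (s := Finset.range z.1) (fun i hi ↦ by simp_all)]
  refine Finset.sum_congr rfl fun i hi ↦ ?_
  simp only [Finset.mem_range.1 hi, if_true, he, inv_pow]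
  rw [← div_eq_mul_inv, div_right_comm]

lemma tendsto_neg_log_jointCdf (hr : 2 ≤ r) (hp0 : 0 < p) (hp : r * p < 1) {c : ℝ}
    (hc : Tendsto (fun n ↦ survival r p n / (r * p) ^ n) atTop (𝓝 c)) {ι : Type*} {l : Filter ι}
    {D M : ι → ℕ} (hD : Tendsto D l atTop) (hM : Tendsto M l atTop) :
    Tendsto (fun k ↦ -Real.log (jointCdf r p (M k) (D k) (M k)) /
      (r ^ D k * (r * p) ^ M k)) l (𝓝 (c * r * (1 - p) / (r - 1))) := by
  have h := (tendsto_neg_log_jointCdf_succ hr hp0 hp hc).comp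
    (hD.prodMk ((tendsto_sub_atTop_nat 1).comp hM))
  refine h.congr' ?_
  filter_upwards [hM.eventually (eventually_ge_atTop 1)] with k hk
  simp only [Function.comp_apply, Nat.sub_add_cancel hk]

/-- Used with `d` fixed, to show that R_d is almost surely finite. -/
lemma tendsto_jointCdf_one (hr : 2 ≤ r) (hp0 : 0 < p) (hp : r * p < 1) (d : ℕ) :
    Tendsto (fun m ↦ jointCdf r p m d m) atTop (𝓝 1) := by
  have hx0 : 0 < (r : ℝ) * p := by positivity
  have hr' : (2 : ℝ) ≤ r := by exact_mod_cast hr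
  have hq : Tendsto (survival r p) atTop (𝓝 0) := by
    refine squeeze_zero (fun n ↦ (survival_mem hr hp0 hp n).1.le) (survival_le_pow hr hp0 hp) ?_
    simpa using (tendsto_pow_atTop_nhds_zero_of_lt_one hx0.le hp).const_mul p
  induction d with
  | zero => simpa [jointCdf] using hq.const_sub 1
  | succ d ih =>
    rw [← tendsto_add_atTop_iff_nat 1]
    have hs : Tendsto (fun n ↦ condSurvival r p (n + 1) d n) atTop (𝓝 0) :=
      squeeze_zero (fun n ↦ condSurvival_nonneg hr hp0 hp d n.le_succ)
        (fun n ↦ condSurvival_le hr hp0 hp n.le_succ) hq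
    have h := (((tendsto_add_atTop_iff_nat 1).2 ih).pow r).mul
      (((((hs.const_sub 1).pow r).const_sub 1).const_mul p).const_sub 1)
    simp only [sub_zero, one_pow, sub_self, mul_zero, mul_one] at h
    exact h.congr fun n ↦ (jointCdf_succ_succ hr hp0 hp (n + 1) d n).symm

end Analysis

/-! ### Open paths and their decomposition at the root. -/

section Paths

variable {r : ℕ}

/-- There is an open path of `n + 1` nodes, directed away from the root, whose first node is `v`. -/
def OpenPath (x : Node r → ℕ) : ℕ → Node r → Prop
  | 0, v => x v = 1
  | n + 1, v => x v = 1 ∧ ∃ i, OpenPath x n (i :: v)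

/-- The restriction of a configuration to the subtree of the `i`-th child of the root. -/
def subtree (i : Fin r) (x : Node r → ℕ) : Node r → ℕ := fun v ↦ x (v ++ [i])

lemma OpenPath.root_eq_one {x : Node r → ℕ} {n : ℕ} {v : Node r} (h : OpenPath x n v) :
    x v = 1 := by
  cases n with
  | zero => exact h
  | succ n => exact h.1

lemma OpenPath.mono {x : Node r → ℕ} {m n : ℕ} {v : Node r} (h : OpenPath x n v) (hmn : m ≤ n) :
    OpenPath x m v := by
  induction n generalizing m v with
  | zero => obtain rfl := Nat.le_zero.1 hmn; exact h
  | succ n ih =>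
    cases m with
    | zero => exact h.1
    | succ m =>
      obtain ⟨h1, i, hi⟩ := h
      exact ⟨h1, i, ih hi (by lia)⟩

lemma openPath_subtree (i : Fin r) (x : Node r → ℕ) (n : ℕ) (v : Node r) :
    OpenPath (subtree i x) n v ↔ OpenPath x n (v ++ [i]) := by
  induction n generalizing v with
  | zero => rfl
  | succ n ih => simp only [OpenPath, ih, subtree, List.cons_append]

/-- The index of `OpenPath` counts edges, so a run of more than m nodes exists at v exactly when
`OpenPath x m v` holds. -/
lemma openPath_iff_exists_run (x : Node r → ℕ) (n : ℕ) (v : Node r) :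
    OpenPath x n v ↔ ∃ A : Run r, A.root = v ∧ A.size = n + 1 ∧ A.IsOpen x := by
  constructor
  · intro h
    suffices ∃ t : List (Node r), (v :: t).IsChain IsParent ∧ t.length = n ∧
        ∀ w ∈ v :: t, x w = 1 by
      obtain ⟨t, h1, h2, h3⟩ := this
      exact ⟨⟨v, t, h1⟩, rfl, by simp [Run.size, Run.nodes, h2], h3⟩
    induction n generalizing v with
    | zero => exact ⟨[], by simp, rfl, by simpa using show x v = 1 from h⟩
    | succ n ih =>
      obtain ⟨h0, i, hi⟩ := h
      obtain ⟨t, h1, h2, h3⟩ := ih _ hi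
      refine ⟨(i :: v) :: t, List.isChain_cons_cons.2 ⟨⟨i, rfl⟩, h1⟩, by simp [h2], ?_⟩
      rintro w (_ | ⟨_, hw⟩)
      exacts [h0, h3 w hw]
  · rintro ⟨⟨_, t, hc⟩, rfl, hs, ho⟩
    simp only [Run.size, Run.nodes, List.length_cons, add_left_inj, Run.IsOpen] at hs ho ⊢
    rename_i v
    induction n generalizing v t with
    | zero => exact ho v (by simp)
    | succ n ih =>
      cases t with
      | nil => simp at hs
      | cons w t =>
        obtain ⟨⟨i, rfl⟩, hc'⟩ := List.isChain_cons_cons.1 hc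
        exact ⟨ho v (by simp), i, ih _ t hc'
          (fun u hu ↦ ho u (List.mem_cons_of_mem _ hu)) (by simpa using hs)⟩

lemma longestRun_le_iff (d m : ℕ) (x : Node r → ℕ) :
    longestRun d x ≤ m ↔ ∀ v : Node r, gen v ≤ d → ¬ OpenPath x m v := by
  simp only [longestRun, iSup_le_iff, Nat.cast_le, and_imp]
  constructor
  · intro h v hv hp
    obtain ⟨A, rfl, hs, ho⟩ := (openPath_iff_exists_run x m v).1 hp
    have := h A hv ho
    lia
  · intro h A hA ho
    by_contra! hlt
    have hs : A.size = (A.size - 1) + 1 := by lia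
    exact h A.root hA (((openPath_iff_exists_run x _ _).2 ⟨A, rfl, hs, ho⟩).mono (by lia))

/-- No open run of more than `m` nodes starts in the generations up to `d`, and no open run of more
than `j` nodes starts at the root. -/
def ShortRuns (d m j : ℕ) (x : Node r → ℕ) : Prop :=
  (∀ v : Node r, gen v ≤ d → ¬ OpenPath x m v) ∧ ¬ OpenPath x j []

lemma longestRun_le_iff_shortRuns (d m : ℕ) (x : Node r → ℕ) :
    longestRun d x ≤ m ↔ ShortRuns d m m x := by
  rw [longestRun_le_iff]
  exact ⟨fun h ↦ ⟨h, h [] (by simp [gen])⟩, fun h ↦ h.1⟩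

lemma shortRuns_zero {m j : ℕ} (hj : j ≤ m) (x : Node r → ℕ) :
    ShortRuns 0 m j x ↔ ¬ OpenPath x j [] := by
  refine ⟨fun h ↦ h.2, fun h ↦ ⟨fun v hv hp ↦ h ?_, h⟩⟩
  obtain rfl := List.length_eq_zero_iff.1 (Nat.le_zero.1 hv)
  exact hp.mono hj

lemma forall_gen_le_succ (d m : ℕ) (x : Node r → ℕ) :
    (∀ v : Node r, gen v ≤ d + 1 → ¬ OpenPath x m v) ↔
      ¬ OpenPath x m [] ∧ ∀ i, ShortRuns d m m (subtree i x) := by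
  simp_rw [← longestRun_le_iff_shortRuns, longestRun_le_iff, openPath_subtree]
  constructor
  · exact fun h ↦ ⟨h [] (by simp [gen]), fun i v hv ↦ h _ (by simpa [gen] using hv)⟩
  · rintro ⟨h0, h⟩ v hv
    rcases List.eq_nil_or_concat v with rfl | ⟨w, i, rfl⟩
    · exact h0
    · rw [List.concat_eq_append]
      exact h i w (by simpa [gen] using hv)

lemma not_openPath_succ (n : ℕ) (x : Node r → ℕ) :
    ¬ OpenPath x (n + 1) [] ↔
      (x [] ≠ 1 ∨ x [] = 1 ∧ ∀ i, ¬ OpenPath (subtree i x) n []) := by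
  simp only [OpenPath, openPath_subtree, List.nil_append]
  by_cases h : x [] = 1 <;> simp [h]

lemma shortRuns_succ_zero (d m : ℕ) (x : Node r → ℕ) :
    ShortRuns (d + 1) m 0 x ↔ x [] ≠ 1 ∧ ∀ i, ShortRuns d m m (subtree i x) := by
  rw [ShortRuns, forall_gen_le_succ]
  exact ⟨fun h ↦ ⟨h.2, h.1.2⟩, fun h ↦ ⟨⟨fun hp ↦ h.1 hp.root_eq_one, h.2⟩, h.1⟩⟩

/-- A closed root only requires the subtrees to have no run of more than m nodes; an open root
lengthens each child's path by one, which lowers the bound there to j. As j + 1 ≤ m, the condition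
at the root for m is then automatic. -/
lemma shortRuns_succ_succ {d m j : ℕ} (hj : j + 1 ≤ m) (x : Node r → ℕ) :
    ShortRuns (d + 1) m (j + 1) x ↔ (x [] ≠ 1 ∧ ∀ i, ShortRuns d m m (subtree i x)) ∨
      (x [] = 1 ∧ ∀ i, ShortRuns d m j (subtree i x)) := by
  have hroot : ∀ y : Node r → ℕ, ShortRuns d m m y ∧ ¬ OpenPath y j [] ↔ ShortRuns d m j y :=
    fun y ↦ ⟨fun h ↦ ⟨h.1.1, h.2⟩, fun h ↦ ⟨⟨h.1, h.1 [] (by simp [gen])⟩, h.2⟩⟩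
  rw [ShortRuns, forall_gen_le_succ, not_openPath_succ]
  simp_rw [← hroot]
  constructor
  · rintro ⟨⟨-, h⟩, h1 | ⟨h1, h2⟩⟩
    exacts [.inl ⟨h1, h⟩, .inr ⟨h1, fun i ↦ ⟨h i, h2 i⟩⟩]
  · rintro (⟨h1, h2⟩ | ⟨h1, h2⟩)
    · exact ⟨⟨fun hp ↦ h1 hp.root_eq_one, h2⟩, .inl h1⟩
    · have h3 := (not_openPath_succ j x).2 (.inr ⟨h1, fun i ↦ (h2 i).2⟩)
      exact ⟨⟨fun hp ↦ h3 (hp.mono hj), fun i ↦ (h2 i).1⟩, .inr ⟨h1, fun i ↦ (h2 i).2⟩⟩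

lemma measurableSet_openPath (n : ℕ) (v : Node r) : MeasurableSet {x | OpenPath x n v} := by
  induction n generalizing v with
  | zero => exact measurableSet_eq_fun (measurable_pi_apply v) measurable_const
  | succ n ih =>
    have : {x : Node r → ℕ | OpenPath x (n + 1) v} =
        {x | x v = 1} ∩ ⋃ i, {x | OpenPath x n (i :: v)} := by ext; simp [OpenPath]
    rw [this]
    exact (measurableSet_eq_fun (measurable_pi_apply v) measurable_const).inter
      (.iUnion fun i ↦ ih _)

lemma measurableSet_shortRuns (d m j : ℕ) :
    MeasurableSet {x : Node r → ℕ | ShortRuns d m j x} := by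
  have : {x : Node r → ℕ | ShortRuns d m j x} =
      (⋂ (v : Node r) (_ : gen v ≤ d), {x | OpenPath x m v}ᶜ) ∩ {x | OpenPath x j []}ᶜ := by
    ext; simp [ShortRuns]
  rw [this]
  exact (MeasurableSet.iInter fun v ↦ .iInter fun _ ↦ (measurableSet_openPath m v).compl).inter
    (measurableSet_openPath j []).compl

end Paths

/-! ### Independence of the subtrees and the distribution function of R_d. -/

section Probability

/-- Events depending on disjoint subfamilies of a family of independent random variables are
independent. -/
lemma measure_biInter_eq_prod_of_pairwiseDisjoint {Ω ι κ : Type*} {β : ι → Type*}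
    [MeasurableSpace Ω] {μ : Measure Ω} [m : ∀ v, MeasurableSpace (β v)] {X : (v : ι) → Ω → β v}
    (hX : ∀ v, Measurable (X v)) (hind : iIndepFun X μ) (S : κ → Set ι)
    (hS : Pairwise (Function.onFun Disjoint S)) (A : κ → Set Ω)
    (hA : ∀ i, MeasurableSet[⨆ v ∈ S i, (m v).comap (X v)] (A i)) (s : Finset κ) :
    μ (⋂ i ∈ s, A i) = ∏ i ∈ s, μ (A i) := by
  classical
  have := hind.isProbabilityMeasure
  induction s using Finset.induction_on with
  | empty => simp
  | insert a s has ih =>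
    rw [Finset.set_biInter_insert, Finset.prod_insert has, ← ih]
    have h := indep_iSup_of_disjoint (fun v ↦ (hX v).comap_le) hind.iIndep
      (S := S a) (T := ⋃ i ∈ s, S i) (by
        simp only [Set.disjoint_iUnion_right]
        exact fun i hi ↦ hS (by rintro rfl; exact has hi))
    refine (Indep_iff _ _ μ).1 h _ _ (hA a) ?_
    refine Finset.measurableSet_biInter _ fun i hi ↦ ?_
    have hle : ⨆ v ∈ S i, (m v).comap (X v) ≤ ⨆ v ∈ ⋃ i ∈ s, S i, (m v).comap (X v) :=
      biSup_mono fun v hv ↦ Set.mem_biUnion (Finset.mem_coe.2 hi) hv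
    exact hle _ (hA i)

variable {Ω : Type*} [MeasurableSpace Ω] {μ : Measure Ω} {r : ℕ} {p : ℝ} {X : Node r → Ω → ℕ}

lemma IsBernoulliPercolation.subtree (hX : IsBernoulliPercolation μ r p X) (i : Fin r) :
    IsBernoulliPercolation μ r p fun v ↦ X (v ++ [i]) where
  measurable _ := hX.measurable _
  indep := hX.indep.precomp (List.append_left_injective [i])
  prob_one _ := hX.prob_one _
  prob_zero _ := hX.prob_zero _

lemma IsBernoulliPercolation.prob_ne_one (hX : IsBernoulliPercolation μ r p X) (v : Node r) :
    μ.real {ω | X v ω ≠ 1} = 1 - p := by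
  have := hX.indep.isProbabilityMeasure
  rw [← hX.prob_one v, ← probReal_compl_eq_one_sub
    (measurableSet_eq_fun (hX.measurable v) measurable_const)]
  rfl

/-- The state of the root and the configurations in the subtrees of its children are
independent. -/
lemma IsBernoulliPercolation.real_root_and_subtrees (hX : IsBernoulliPercolation μ r p X)
    (B : Set ℕ) {A : Set (Node r → ℕ)} (hA : MeasurableSet A) {a : ℝ}
    (ha : ∀ i, μ.real {ω | TreePercolation.subtree i (fun v ↦ X v ω) ∈ A} = a) :
    μ.real {ω | X [] ω ∈ B ∧ ∀ i, TreePercolation.subtree i (fun v ↦ X v ω) ∈ A} =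
      μ.real {ω | X [] ω ∈ B} * a ^ r := by
  -- The block `none` is the root and `some i` the i-th subtree. The first choice is the last entry
  -- of the list, so the blocks are disjoint.
  let S : Option (Fin r) → Set (Node r) := fun o ↦ o.elim {[]} fun i ↦ Set.range (· ++ [i])
  let E : Option (Fin r) → Set Ω := fun o ↦ o.elim {ω | X [] ω ∈ B}
    fun i ↦ {ω | TreePercolation.subtree i (fun v ↦ X v ω) ∈ A}
  have hS : Pairwise (Function.onFun Disjoint S) := by
    rintro (_ | i) (_ | j) hij <;> simp only [Function.onFun, Set.disjoint_left, S]
    · exact absurd rfl hij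
    · simp
    · simp
    · rintro _ ⟨v, rfl⟩ ⟨w, hw⟩
      have := List.append_inj_right' hw rfl
      simp_all
  have hE : ∀ o, MeasurableSet[⨆ v ∈ S o, (⊤ : MeasurableSpace ℕ).comap (X v)] (E o) := by
    rintro (_ | i)
    · have hle : (⊤ : MeasurableSpace ℕ).comap (X []) ≤
          ⨆ v ∈ S none, (⊤ : MeasurableSpace ℕ).comap (X v) :=
        le_biSup (fun v ↦ (⊤ : MeasurableSpace ℕ).comap (X v)) rfl
      exact hle _ ⟨B, trivial, rfl⟩
    · have hm : @Measurable Ω (Node r → ℕ) (⨆ v ∈ S (some i), (⊤ : MeasurableSpace ℕ).comap (X v))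
          _ fun ω ↦ TreePercolation.subtree i (fun v ↦ X v ω) := by
        refine @measurable_pi_lambda _ _ _ (_) _ _ fun v ↦ ?_
        refine Measurable.of_comap_le ?_
        exact le_biSup (fun v ↦ (⊤ : MeasurableSpace ℕ).comap (X v))
          (show v ++ [i] ∈ S (some i) from ⟨v, rfl⟩)
      exact hm hA
  have h := measure_biInter_eq_prod_of_pairwiseDisjoint hX.measurable hX.indep S hS E hE Finset.univ
  have hset : {ω | X [] ω ∈ B ∧ ∀ i, TreePercolation.subtree i (fun v ↦ X v ω) ∈ A} =
      ⋂ o ∈ Finset.univ, E o := by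
    ext ω
    simp only [Finset.mem_univ, Set.iInter_true, Set.mem_iInter, Option.forall]
    rfl
  rw [hset, measureReal_def, h, Fintype.prod_option, ENNReal.toReal_mul, ENNReal.toReal_prod]
  change _ * ∏ i, μ.real {ω | TreePercolation.subtree i (fun v ↦ X v ω) ∈ A} = _
  simp only [ha, Finset.prod_const, Finset.card_univ, Fintype.card_fin]
  rfl

lemma IsBernoulliPercolation.measurable_config (hX : IsBernoulliPercolation μ r p X) :
    Measurable fun ω v ↦ X v ω := measurable_pi_lambda _ hX.measurable

/-- The probability of an event that requires the configurations in the subtrees of the children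
of the root to lie in a set depending on the state of the root. -/
lemma IsBernoulliPercolation.real_or (hX : IsBernoulliPercolation μ r p X)
    {A B : Set (Node r → ℕ)} (hA : MeasurableSet A) (hB : MeasurableSet B) {a b : ℝ}
    (ha : ∀ i, μ.real {ω | TreePercolation.subtree i (fun v ↦ X v ω) ∈ A} = a)
    (hb : ∀ i, μ.real {ω | TreePercolation.subtree i (fun v ↦ X v ω) ∈ B} = b) :
    μ.real {ω | (X [] ω ≠ 1 ∧ ∀ i, TreePercolation.subtree i (fun v ↦ X v ω) ∈ A) ∨
      (X [] ω = 1 ∧ ∀ i, TreePercolation.subtree i (fun v ↦ X v ω) ∈ B)} =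
      (1 - p) * a ^ r + p * b ^ r := by
  have := hX.indep.isProbabilityMeasure
  have h1 := hX.real_root_and_subtrees {1}ᶜ hA ha
  have h2 := hX.real_root_and_subtrees {1} hB hb
  simp only [Set.mem_compl_iff, Set.mem_singleton_iff] at h1 h2
  rw [← hX.prob_ne_one [], ← hX.prob_one [], ← h1, ← h2, Set.ofPred_or, measureReal_union]
  · exact Set.disjoint_left.2 fun ω h h' ↦ h.1 h'.1
  · have hsub : ∀ i, MeasurableSet {ω | TreePercolation.subtree i (fun v ↦ X v ω) ∈ B} := fun i ↦
      (hX.subtree i).measurable_config hB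
    exact (measurableSet_eq_fun (hX.measurable _) measurable_const).inter
      (by simpa only [← Set.ofPred_forall] using! MeasurableSet.iInter hsub)

lemma IsBernoulliPercolation.real_not_openPath (hX : IsBernoulliPercolation μ r p X) (n : ℕ) :
    μ.real {ω | ¬ OpenPath (fun v ↦ X v ω) n []} = 1 - survival r p n := by
  have := hX.indep.isProbabilityMeasure
  induction n generalizing X with
  | zero => exact hX.prob_ne_one []
  | succ n ih =>
    -- A closed root imposes nothing on the subtrees, hence the whole space with probability 1.
    have h := hX.real_or MeasurableSet.univ (measurableSet_openPath n []).compl (a := 1)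
      (by simp) (fun i ↦ ih (hX.subtree i))
    simp only [not_openPath_succ]
    simp only [Set.mem_univ, implies_true, and_true, Set.mem_compl_iff, Set.mem_ofPred_eq,
      one_pow, mul_one] at h
    rw [h, survival]
    ring

lemma IsBernoulliPercolation.real_shortRuns (hX : IsBernoulliPercolation μ r p X) {d m j : ℕ}
    (hj : j ≤ m) : μ.real {ω | ShortRuns d m j (fun v ↦ X v ω)} = jointCdf r p m d j := by
  induction d generalizing X j with
  | zero => simpa only [shortRuns_zero hj] using! hX.real_not_openPath j
  | succ d ih =>
    have hm : ∀ i, μ.real {ω | TreePercolation.subtree i (fun v ↦ X v ω) ∈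
        {x | ShortRuns d m m x}} = jointCdf r p m d m := fun i ↦ ih (hX.subtree i) le_rfl
    cases j with
    | zero =>
      have h := hX.real_root_and_subtrees {1}ᶜ (measurableSet_shortRuns d m m) hm
      simp only [Set.mem_compl_iff, Set.mem_singleton_iff] at h
      simp only [shortRuns_succ_zero]
      rw [jointCdf, ← hX.prob_ne_one []]
      exact h
    | succ j =>
      simp only [shortRuns_succ_succ hj]
      exact hX.real_or (measurableSet_shortRuns d m m) (measurableSet_shortRuns d m j) hm
        fun i ↦ ih (hX.subtree i) (by lia)

/-- The distribution function of `R_d`. -/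
lemma IsBernoulliPercolation.real_R_le (hX : IsBernoulliPercolation μ r p X) (d m : ℕ) :
    μ.real {ω | R X d ω ≤ m} = jointCdf r p m d m := by
  simp only [R, longestRun_le_iff_shortRuns]
  exact hX.real_shortRuns le_rfl

lemma IsBernoulliPercolation.measurable_R (hX : IsBernoulliPercolation μ r p X) (d : ℕ) :
    Measurable (R X d) := by
  have hle : ∀ a : ℕ∞, MeasurableSet {ω | R X d ω ≤ a} := fun a ↦ by
    induction a using ENat.recTopCoe with
    | top => simp
    | coe m =>
      have := hX.measurable_config (measurableSet_shortRuns d m m)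
      simpa only [R, longestRun_le_iff_shortRuns] using! this
  refine measurable_to_countable' fun a ↦ ?_
  have : R X d ⁻¹' {a} = {ω | R X d ω ≤ a} ∩ ⋂ b : ℕ∞, ⋂ _ : b < a, {ω | R X d ω ≤ b}ᶜ := by
    ext ω
    simp only [Set.mem_preimage, Set.mem_singleton_iff, Set.mem_inter_iff, Set.mem_ofPred_eq,
      Set.mem_iInter, Set.mem_compl_iff, not_le]
    exact ⟨fun h ↦ ⟨h.le, fun b hb ↦ h ▸ hb⟩, fun h ↦ h.1.antisymm (le_of_forall_lt h.2)⟩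
  rw [this]
  exact (hle a).inter (.iInter fun b ↦ .iInter fun _ ↦ (hle b).compl)

lemma IsBernoulliPercolation.real_lt_R_zero (hX : IsBernoulliPercolation μ r p X) (h : ℕ) :
    μ.real {ω | (h : ℕ∞) < R X 0 ω} = survival r p h := by
  have := hX.indep.isProbabilityMeasure
  have hle := hX.real_R_le 0 h
  rw [jointCdf] at hle
  have hmeas : MeasurableSet {ω | R X 0 ω ≤ h} :=
    hX.measurable_R 0 (MeasurableSet.of_discrete (s := Set.Iic (h : ℕ∞)))
  rw [← sub_sub_cancel 1 (survival r p h), ← hle, ← probReal_compl_eq_one_sub hmeas]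
  congr 1
  ext ω
  simp

end Probability

/-! ### Weak convergence on the line and integer parts modulo 1. -/

section WeakConvergence

/-- Convergence of the distribution functions outside a countable set implies weak convergence. -/
lemma tendsto_of_tendsto_real_Iic {ι : Type*} {l : Filter ι} [l.IsCountablyGenerated]
    {μ : ι → ProbabilityMeasure ℝ} {ν : ProbabilityMeasure ℝ} {D : Set ℝ} (hD : D.Countable)
    (h : ∀ y ∉ D, Tendsto (fun i ↦ (μ i : Measure ℝ).real (Set.Iic y)) l
      (𝓝 ((ν : Measure ℝ).real (Set.Iic y)))) : Tendsto μ l (𝓝 ν) := by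
  have hdense : Dense Dᶜ := hD.dense_compl ℝ
  -- Half-open intervals with endpoints off the countable set form a π-system containing small
  -- neighbourhoods of every point.
  refine (isPiSystem_Ioc_mem Dᶜ Dᶜ).tendsto_probabilityMeasure_of_tendsto_of_mem ?_ ?_ ?_
  · rintro _ ⟨a, -, b, -, -, rfl⟩
    exact measurableSet_Ioc
  · intro u hu x hx
    obtain ⟨a, b, hab, hsub⟩ := mem_nhds_iff_exists_Ioo_subset.1 (hu.mem_nhds hx)
    obtain ⟨a', ha', ha⟩ := hdense.exists_between hab.1
    obtain ⟨b', hb', hb⟩ := hdense.exists_between hab.2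
    exact ⟨_, ⟨a', ha', b', hb', ha.2.trans hb.1, rfl⟩, Ioc_mem_nhds ha.2 hb.1,
      fun z hz ↦ hsub ⟨ha.1.trans hz.1, hz.2.trans_lt hb.2⟩⟩
  · rintro _ ⟨a, ha, b, hb, hab, rfl⟩
    have key : ∀ m : ProbabilityMeasure ℝ, ((m (Set.Ioc a b) : NNReal) : ℝ) =
        (m : Measure ℝ).real (Set.Iic b) - (m : Measure ℝ).real (Set.Iic a) := fun m ↦ by
      have : Set.Ioc a b = Set.Iic b \ Set.Iic a := by ext; simp [and_comm]
      rw [← ProbabilityMeasure.measureReal_eq_coe_coeFn, this,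
        measureReal_sdiff (Set.Iic_subset_Iic.2 hab.le) measurableSet_Iic]
    rw [← NNReal.tendsto_coe]
    simp only [key]
    exact (h b hb).sub (h a ha)

/-- The probability measure with distribution function `z ↦ exp (-C x ^ z)`. -/
lemma exists_measure_Iic_eq_exp_neg_mul_rpow {x C : ℝ} (hx0 : 0 < x) (hx : x < 1) (hC : 0 < C) :
    ∃ (ζ : Measure ℝ) (_ : IsProbabilityMeasure ζ),
      ∀ z : ℝ, ζ.real (Set.Iic z) = Real.exp (-C * x ^ z) := by
  have hcont : Continuous fun z : ℝ ↦ Real.exp (-C * x ^ z) :=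
    Real.continuous_exp.comp ((Real.continuous_const_rpow hx0.ne').const_mul _)
  let f : StieltjesFunction ℝ :=
    { toFun := fun z ↦ Real.exp (-C * x ^ z)
      mono' := fun a b hab ↦ by
        have := Real.rpow_le_rpow_of_exponent_ge hx0 hx.le hab
        refine Real.exp_le_exp.2 ?_
        nlinarith
      right_continuous' := fun z ↦ hcont.continuousWithinAt }
  have h0 : Tendsto f atBot (𝓝 0) := by
    refine Real.tendsto_exp_atBot.comp ?_
    exact (tendsto_rpow_atBot_of_base_lt_one x hx0 hx).const_mul_atTop_of_neg (by linarith)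
  have h1 : Tendsto f atTop (𝓝 1) := by
    have := (tendsto_rpow_atTop_of_base_lt_one x (by linarith) hx).const_mul (-C)
    rw [mul_zero] at this
    have := (Real.continuous_exp.tendsto 0).comp this
    rwa [Real.exp_zero] at this
  refine ⟨f.measure, f.isProbabilityMeasure h0 h1, fun z ↦ ?_⟩
  rw [measureReal_def, f.measure_Iic h0, sub_zero, ENNReal.toReal_ofReal (Real.exp_nonneg _)]

lemma real_Iio_of_real_Iic {ζ : Measure ℝ} [IsFiniteMeasure ζ] {f : ℝ → ℝ} (hf : Continuous f)
    (h : ∀ z, ζ.real (Set.Iic z) = f z) (z : ℝ) : ζ.real (Set.Iio z) = f z := by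
  refine le_antisymm (h z ▸ measureReal_mono Set.Iio_subset_Iic_self) ?_
  refine le_of_tendsto (hf.continuousWithinAt (s := Set.Iio z) (x := z)).tendsto ?_
  filter_upwards [self_mem_nhdsWithin] with w hw
  rw [← h w]
  exact measureReal_mono (Set.Iic_subset_Iio.2 hw)

/-- The distribution function of the law of `⌊Z + a⌋ - a`. -/
lemma real_map_floor_Iic {ζ : Measure ℝ} [IsFiniteMeasure ζ] {f : ℝ → ℝ} (hf : Continuous f)
    (h : ∀ z, ζ.real (Set.Iic z) = f z) (a y : ℝ) :
    (ζ.map fun z : ℝ ↦ (⌊z + a⌋ : ℝ) - a).real (Set.Iic y) = f (⌊y + a⌋ - a + 1) := by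
  have hm : Measurable fun z : ℝ ↦ (⌊z + a⌋ : ℝ) - a := by fun_prop
  -- [z + a] - a ≤ y means z < [y + a] + 1 - a; the inequality is strict, and continuity of f
  -- removes the atom.
  rw [map_measureReal_apply hm measurableSet_Iic, ← real_Iio_of_real_Iic hf h]
  congr 1
  ext z
  rw [Set.mem_preimage, Set.mem_Iic, sub_le_iff_le_add, ← Int.le_floor, ← Int.lt_add_one_iff,
    Int.floor_lt, Set.mem_Iio]
  push_cast
  constructor <;> intro h <;> linarith

/-- The map t ↦ [y + t] - t has period 1, so it descends to the circle; it is continuous at a unless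
y + a is an integer. -/
lemma tendsto_floor_add_sub_of_tendsto_unitAddCircle {ι : Type*} {l : Filter ι} {t : ι → ℝ}
    {a y : ℝ} (h : Tendsto (fun k ↦ (t k : UnitAddCircle)) l (𝓝 (a : UnitAddCircle)))
    (hy : y ∉ Set.range fun n : ℤ ↦ (n : ℝ) - a) :
    Tendsto (fun k ↦ (⌊y + t k⌋ : ℝ) - t k) l (𝓝 (⌊y + a⌋ - a)) := by
  set g : ℝ → ℝ := fun t ↦ (⌊y + t⌋ : ℝ) - t with hg
  have hper : Function.Periodic g 1 := fun t ↦ by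
    simp only [hg, ← add_assoc, Int.floor_add_one]
    push_cast
    ring
  have hga : Tendsto g (𝓝 a) (𝓝 (g a)) := by
    have h1 : (⌊y + a⌋ : ℝ) < y + a := lt_of_le_of_ne (Int.floor_le _) fun h ↦
      hy ⟨⌊y + a⌋, by simp only; linarith⟩
    have h2 := Int.lt_floor_add_one (y + a)
    refine (tendsto_const_nhds.sub tendsto_id : Tendsto (fun t ↦ (⌊y + a⌋ : ℝ) - t) _ _).congr' ?_
    filter_upwards [Ioo_mem_nhds (show (⌊y + a⌋ : ℝ) - y < a by linarith)
      (show a < (⌊y + a⌋ : ℝ) + 1 - y by linarith)] with t ht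
    have : ⌊y + t⌋ = ⌊y + a⌋ := Int.floor_eq_iff.2 ⟨by linarith [ht.1], by linarith [ht.2]⟩
    simp only [hg, this]
  have hlift : Tendsto hper.lift (𝓝 (a : UnitAddCircle)) (𝓝 (g a)) := by
    rw [QuotientAddGroup.nhds_eq, tendsto_map'_iff]
    exact hga
  exact hlift.comp h

end WeakConvergence

/-! ### The centering: (rp)^(-ν_d) = r^d. -/

section Centering

variable {r : ℕ} {p : ℝ}

lemma logb_sub_one_pos (hr : 2 ≤ r) (hp0 : 0 < p) (hp : r * p < 1) :
    0 < Real.logb r (1 / p) - 1 := by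
  have hr' : (1 : ℝ) < r := by exact_mod_cast hr
  rw [sub_pos, Real.lt_logb_iff_rpow_lt hr' (by positivity), Real.rpow_one, lt_div_iff₀ hp0]
  exact hp

lemma rpow_neg_nu (hr : 2 ≤ r) (hp0 : 0 < p) (hp : r * p < 1) (d : ℕ) :
    ((r : ℝ) * p) ^ (-nu r p d) = r ^ d := by
  have hr' : (1 : ℝ) < r := by exact_mod_cast hr
  have hL := logb_sub_one_pos hr hp0 hp
  have hlog := Real.log_pos hr'
  have e : Real.log (r * p) = -(Real.log r * (Real.logb r (1 / p) - 1)) := by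
    rw [Real.log_mul (by positivity) hp0.ne', Real.logb, one_div, Real.log_inv]
    field_simp
    ring
  rw [Real.rpow_def_of_pos (by positivity), e, nu,
    ← Real.rpow_natCast, Real.rpow_def_of_pos (by positivity)]
  congr 1
  field_simp

lemma pow_mul_pow_eq_rpow_sub_nu (hr : 2 ≤ r) (hp0 : 0 < p) (hp : r * p < 1) (d m : ℕ) :
    (r : ℝ) ^ d * ((r : ℝ) * p) ^ m = ((r : ℝ) * p) ^ ((m : ℝ) - nu r p d) := by
  rw [sub_eq_neg_add, Real.rpow_add (by positivity), rpow_neg_nu hr hp0 hp, Real.rpow_natCast]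

lemma tendsto_nu_atTop (hr : 2 ≤ r) (hp0 : 0 < p) (hp : r * p < 1) :
    Tendsto (nu r p) atTop atTop :=
  tendsto_natCast_atTop_atTop.atTop_div_const (logb_sub_one_pos hr hp0 hp)

lemma jointCdf_eq_exp (hr : 2 ≤ r) (hp0 : 0 < p) (hp : r * p < 1) (d m : ℕ) :
    jointCdf r p m d m = Real.exp (-(-Real.log (jointCdf r p m d m) / (r ^ d * (r * p) ^ m) *
      (r * p) ^ ((m : ℝ) - nu r p d))) := by
  have h1 := (jointCdf_pos_and_mono hr hp0 hp m d).1 m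
  rw [← pow_mul_pow_eq_rpow_sub_nu hr hp0 hp, div_mul_cancel₀ _ (by positivity), neg_neg,
    Real.exp_log h1]

end Centering

/-! ### Finiteness, tails, the strong law and weak limits of the longest run. -/

section LongestRun

variable {Ω : Type*} [MeasurableSpace Ω] {μ : Measure Ω} {r : ℕ} {p : ℝ} {X : Node r → Ω → ℕ}

lemma IsBernoulliPercolation.ae_R_lt_top (hX : IsBernoulliPercolation μ r p X) (hr : 2 ≤ r)
    (hp0 : 0 < p) (hp : r * p < 1) : ∀ᵐ ω ∂μ, ∀ d, R X d ω < ⊤ := by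
  have := hX.indep.isProbabilityMeasure
  refine ae_all_iff.2 fun d ↦ ?_
  have h0 : μ.real {ω | ¬ R X d ω < ⊤} ≤ 0 := by
    have hlim := (tendsto_jointCdf_one hr hp0 hp d).const_sub 1
    rw [sub_self] at hlim
    refine ge_of_tendsto' hlim fun m ↦ ?_
    have hm : MeasurableSet {ω | R X d ω ≤ m} :=
      hX.measurable_R d (MeasurableSet.of_discrete (s := Set.Iic (m : ℕ∞)))
    rw [← hX.real_R_le d m, ← probReal_compl_eq_one_sub hm]
    refine measureReal_mono fun ω hω hle ↦ hω ?_
    exact lt_of_le_of_lt hle (ENat.natCast_lt_top m)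
  exact (measureReal_eq_zero_iff (measure_ne_top _ _)).1 (h0.antisymm measureReal_nonneg)

lemma IsBernoulliPercolation.measurable_centered (hX : IsBernoulliPercolation μ r p X) (d : ℕ) :
    Measurable (centered p X d) := by
  have : Measurable fun n : ℕ∞ ↦ (n.toNat : ℝ) - nu r p d := .of_discrete
  exact this.comp (hX.measurable_R d)

lemma IsBernoulliPercolation.real_centered_le (hX : IsBernoulliPercolation μ r p X) (hr : 2 ≤ r)
    (hp0 : 0 < p) (hp : r * p < 1) {d : ℕ} {y : ℝ} (hy : 0 ≤ y + nu r p d) :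
    μ.real {ω | centered p X d ω ≤ y} =
      jointCdf r p ⌊y + nu r p d⌋₊ d ⌊y + nu r p d⌋₊ := by
  rw [← hX.real_R_le]
  refine measureReal_congr ?_
  filter_upwards [hX.ae_R_lt_top hr hp0 hp] with ω hω
  refine propext ?_
  change centered p X d ω ≤ y ↔ R X d ω ≤ _
  rw [centered, sub_le_iff_le_add, ← Nat.le_floor_iff hy]
  conv_rhs => rw [← ENat.natCast_toNat (hω d).ne, Nat.cast_le]

lemma IsBernoulliPercolation.tendsto_real_centered_le (hX : IsBernoulliPercolation μ r p X)
    (hr : 2 ≤ r) (hp0 : 0 < p) (hp : r * p < 1) {c : ℝ}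
    (hc : Tendsto (fun n ↦ survival r p n / (r * p) ^ n) atTop (𝓝 c)) {ι : Type*} {l : Filter ι}
    {φ : ι → ℕ} (hφ : Tendsto φ l atTop) {y e : ℝ}
    (he : Tendsto (fun k ↦ (⌊y + nu r p (φ k)⌋ : ℝ) - nu r p (φ k)) l (𝓝 e)) :
    Tendsto (fun k ↦ μ.real {ω | centered p X (φ k) ω ≤ y}) l
      (𝓝 (Real.exp (-(c * r * (1 - p) / (r - 1) * (r * p) ^ e)))) := by
  have hx0 : (0 : ℝ) < r * p := by positivity
  have hν : Tendsto (fun k ↦ y + nu r p (φ k)) l atTop :=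
    tendsto_atTop_add_const_left _ _ ((tendsto_nu_atTop hr hp0 hp).comp hφ)
  have h1 := tendsto_neg_log_jointCdf hr hp0 hp hc hφ (tendsto_nat_floor_atTop.comp hν)
  have h2 : Tendsto (fun k ↦ ((r : ℝ) * p) ^ ((⌊y + nu r p (φ k)⌋ : ℝ) - nu r p (φ k))) l
      (𝓝 ((r * p) ^ e)) := ((Real.continuous_const_rpow hx0.ne').tendsto e).comp he
  refine ((Real.continuous_exp.tendsto _).comp (h1.mul h2).neg).congr' ?_
  filter_upwards [hν.eventually (eventually_ge_atTop 0)] with k hk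
  rw [hX.real_centered_le hr hp0 hp hk, jointCdf_eq_exp hr hp0 hp, natCast_floor_eq_intCast_floor hk]
  rfl

/-- Exponential bounds for the tails of `R_d - ν_d`, uniform in `d`. -/
lemma IsBernoulliPercolation.exists_real_abs_centered_gt_le (hX : IsBernoulliPercolation μ r p X)
    (hr : 2 ≤ r) (hp0 : 0 < p) (hp : r * p < 1) :
    ∃ (K : ℝ) (N : ℕ), ∀ (d : ℕ) (y : ℝ), N ≤ d → 0 ≤ y → y + N + 1 ≤ nu r p d →
      μ.real {ω | y < |centered p X d ω|} ≤ K * (r * p) ^ y := by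
  have := hX.indep.isProbabilityMeasure
  obtain ⟨c, hc0, hc⟩ := exists_tendsto_survival hr hp0 hp
  have hx0 : (0 : ℝ) < r * p := by positivity
  have hr' : (2 : ℝ) ≤ r := by exact_mod_cast hr
  have hp1 : 0 < 1 - p := by nlinarith
  set Λ := c * r * (1 - p) / (r - 1)
  have hΛ0 : 0 < Λ := div_pos (by positivity) (by linarith)
  have hlim := tendsto_neg_log_jointCdf (l := atTop ×ˢ atTop) hr hp0 hp hc tendsto_fst tendsto_snd
  have hev := hlim.eventually (Icc_mem_nhds (show Λ / 2 < Λ by linarith)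
    (show Λ < 2 * Λ by linarith))
  clear_value Λ
  rw [prod_atTop_atTop_eq, eventually_atTop] at hev
  obtain ⟨⟨N₁, N₂⟩, hN⟩ := hev
  -- The first term bounds the upper tail by 1 - F ≤ -log F, the integer part costing a factor
  -- 1/(rp); the second bounds the lower tail by F ≤ 1/(-log F).
  refine ⟨2 * Λ / (r * p) + 2 / Λ, max N₁ N₂, fun d y hd hy hyd ↦ ?_⟩
  set N := max N₁ N₂
  have hb : ∀ m, N ≤ m → Λ / 2 * (r * p) ^ ((m : ℝ) - nu r p d) ≤ -Real.log (jointCdf r p m d m) ∧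
      -Real.log (jointCdf r p m d m) ≤ 2 * Λ * (r * p) ^ ((m : ℝ) - nu r p d) := fun m hm ↦ by
    obtain ⟨h1, h2⟩ := hN (d, m) ⟨le_trans (le_max_left _ _) hd, le_trans (le_max_right _ _) hm⟩
    rw [← pow_mul_pow_eq_rpow_sub_nu hr hp0 hp]
    exact ⟨(le_div_iff₀ (by positivity)).1 h1, (div_le_iff₀ (by positivity)).1 h2⟩
  have hpos : ∀ m, 0 < jointCdf r p m d m := fun m ↦ (jointCdf_pos_and_mono hr hp0 hp m d).1 m
  have hN0 : (0 : ℝ) ≤ N := Nat.cast_nonneg N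
  have hm1 : N ≤ ⌊y + nu r p d⌋₊ := Nat.le_floor (by linarith)
  have hm2 : N ≤ ⌊-y + nu r p d⌋₊ := Nat.le_floor (by linarith)
  have hupper : μ.real {ω | centered p X d ω ≤ y}ᶜ ≤ 2 * Λ / (r * p) * (r * p) ^ y := by
    have hmeas : MeasurableSet {ω | centered p X d ω ≤ y} :=
      hX.measurable_centered d measurableSet_Iic
    rw [probReal_compl_eq_one_sub hmeas, hX.real_centered_le hr hp0 hp (by linarith)]
    have h1 := Real.log_le_sub_one_of_pos (hpos ⌊y + nu r p d⌋₊)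
    have h2 := (hb _ hm1).2
    have h3 : y - 1 ≤ (⌊y + nu r p d⌋₊ : ℝ) - nu r p d := by
      have := Nat.lt_floor_add_one (y + nu r p d)
      linarith
    have h4 := Real.rpow_le_rpow_of_exponent_ge hx0 hp.le h3
    rw [Real.rpow_sub_one hx0.ne'] at h4
    have h5 := mul_le_mul_of_nonneg_left h4 (by positivity : 0 ≤ 2 * Λ)
    rw [mul_div_assoc'] at h5
    rw [div_mul_eq_mul_div]
    linarith
  have hlower : μ.real {ω | centered p X d ω ≤ -y} ≤ 2 / Λ * (r * p) ^ y := by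
    rw [hX.real_centered_le hr hp0 hp (by linarith)]
    set m := ⌊-y + nu r p d⌋₊
    have h1 := (hb _ hm2).1
    have h3 : (m : ℝ) - nu r p d ≤ -y := by
      have := Nat.floor_le (show 0 ≤ -y + nu r p d by linarith)
      linarith
    have h4 := Real.rpow_le_rpow_of_exponent_ge hx0 hp.le h3
    have h5 : Λ / 2 * (r * p) ^ (-y) ≤ (jointCdf r p m d m)⁻¹ := by
      have := Real.log_le_sub_one_of_pos (inv_pos.2 (hpos m))
      rw [Real.log_inv] at this
      have := mul_le_mul_of_nonneg_left h4 (by positivity : 0 ≤ Λ / 2)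
      linarith
    have h6 := inv_anti₀ (by positivity) h5
    rwa [inv_inv, Real.rpow_neg hx0.le, mul_inv, inv_inv, inv_div] at h6
  have hsub : {ω | y < |centered p X d ω|} ⊆
      {ω | centered p X d ω ≤ y}ᶜ ∪ {ω | centered p X d ω ≤ -y} := by
    intro ω hω
    rcases lt_abs.1 (show y < |centered p X d ω| from hω) with h | h
    · exact .inl (not_le.2 h)
    · exact .inr (by simp only [Set.mem_ofPred_eq]; linarith)
  calc _ ≤ _ := measureReal_mono hsub
    _ ≤ _ := measureReal_union_le _ _
    _ ≤ _ := by rw [add_mul]; exact add_le_add hupper hlower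

lemma IsBernoulliPercolation.isTightMeasureSet_centered (hX : IsBernoulliPercolation μ r p X)
    (hr : 2 ≤ r) (hp0 : 0 < p) (hp : r * p < 1) :
    IsTightMeasureSet (Set.range fun d : ℕ ↦ μ.map (centered p X d)) := by
  have := hX.indep.isProbabilityMeasure
  have hx0 : (0 : ℝ) < r * p := by positivity
  obtain ⟨K, N, hK⟩ := hX.exists_real_abs_centered_gt_le hr hp0 hp
  have hp' : ∀ d, IsProbabilityMeasure (μ.map (centered p X d)) := fun d ↦
    Measure.isProbabilityMeasure_map (hX.measurable_centered d).aemeasurable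
  refine isTightMeasureSet_range_of_tendsto_limsup_measure_norm_gt ?_
  have hlim : Tendsto (fun y : ℝ ↦ ENNReal.ofReal (K * (r * p) ^ y)) atTop (𝓝 0) := by
    have := (tendsto_rpow_atTop_of_base_lt_one ((r : ℝ) * p) (by linarith) hp).const_mul K
    rw [mul_zero] at this
    have := (ENNReal.continuous_ofReal.tendsto 0).comp this
    rwa [ENNReal.ofReal_zero] at this
  refine tendsto_of_tendsto_of_tendsto_of_le_of_le' tendsto_const_nhds hlim
    (Eventually.of_forall fun _ ↦ zero_le) ?_
  filter_upwards [eventually_ge_atTop 0] with y hy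
  refine limsup_le_of_le (h := ?_)
  filter_upwards [eventually_ge_atTop N,
    (tendsto_nu_atTop hr hp0 hp).eventually (eventually_ge_atTop (y + N + 1))] with d hd hyd
  rw [Measure.map_apply (hX.measurable_centered d) (measurableSet_lt measurable_const
    measurable_norm), ← ofReal_measureReal]
  exact ENNReal.ofReal_le_ofReal (hK d y hd hy hyd)

lemma IsBernoulliPercolation.ae_eventually_abs_centered_le (hX : IsBernoulliPercolation μ r p X)
    (hr : 2 ≤ r) (hp0 : 0 < p) (hp : r * p < 1) {ε : ℝ} (hε : 0 < ε)
    (hε' : ε < 1 / (Real.logb r (1 / p) - 1)) :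
    ∀ᵐ ω ∂μ, ∀ᶠ d : ℕ in atTop, |centered p X d ω| ≤ ε * d := by
  have := hX.indep.isProbabilityMeasure
  have hx0 : (0 : ℝ) < r * p := by positivity
  obtain ⟨K, N, hK⟩ := hX.exists_real_abs_centered_gt_le hr hp0 hp
  have hsum : Summable fun d : ℕ ↦ K * (((r : ℝ) * p) ^ ε) ^ d :=
    (summable_geometric_of_lt_one (by positivity) (Real.rpow_lt_one hx0.le hp hε)).mul_left K
  have hlin : Tendsto (fun d : ℕ ↦ (1 / (Real.logb r (1 / p) - 1) - ε) * d) atTop atTop :=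
    tendsto_natCast_atTop_atTop.const_mul_atTop (sub_pos.2 hε')
  -- Borel–Cantelli with y = εd: since ε is less than the slope of ν_d, the tail bound applies for
  -- all large d.
  have hs : Summable fun d : ℕ ↦ μ.real {ω | ε * d < |centered p X d ω|} := by
    refine .of_norm_bounded_eventually_nat hsum ?_
    filter_upwards [eventually_ge_atTop N, hlin.eventually (eventually_ge_atTop (N + 1 : ℝ))]
      with d hd hd'
    rw [Real.norm_of_nonneg measureReal_nonneg, ← Real.rpow_natCast, ← Real.rpow_mul hx0.le]
    refine hK d _ hd (by positivity) ?_
    have : nu r p d = 1 / (Real.logb r (1 / p) - 1) * d := by rw [nu]; ring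
    linarith
  have hne := hs.tsum_ofReal_ne_top
  rw [tsum_congr fun d ↦ ofReal_measureReal] at hne
  filter_upwards [ae_eventually_notMem hne] with ω hω
  filter_upwards [hω] with d hd
  exact not_lt.1 hd

/-- The strong law for the longest runs. -/
lemma IsBernoulliPercolation.ae_tendsto_R_div (hX : IsBernoulliPercolation μ r p X)
    (hr : 2 ≤ r) (hp0 : 0 < p) (hp : r * p < 1) :
    ∀ᵐ ω ∂μ, Tendsto (fun d : ℕ ↦ ((R X d ω).toNat : ℝ) / (d : ℝ)) atTop
      (𝓝 (1 / (Real.logb r (1 / p) - 1))) := by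
  have hκ : 0 < 1 / (Real.logb r (1 / p) - 1) := one_div_pos.2 (logb_sub_one_pos hr hp0 hp)
  -- The divisor n + 2 exceeds 1 even at n = 0, as the strict bound on ε requires.
  have hall : ∀ᵐ ω ∂μ, ∀ n : ℕ, ∀ᶠ d : ℕ in atTop,
      |centered p X d ω| ≤ 1 / (Real.logb r (1 / p) - 1) / (n + 2) * d := ae_all_iff.2 fun n ↦
    hX.ae_eventually_abs_centered_le hr hp0 hp (by positivity)
      (div_lt_self hκ (by linarith [(Nat.cast_nonneg n : (0 : ℝ) ≤ n)]))
  filter_upwards [hall] with ω hω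
  rw [Metric.tendsto_nhds]
  intro ε hε
  obtain ⟨n, hn⟩ := exists_nat_gt (1 / (Real.logb r (1 / p) - 1) / ε)
  filter_upwards [hω n, eventually_gt_atTop 0] with d hd hd0
  have hd0' : (0 : ℝ) < d := by exact_mod_cast hd0
  have e : ((R X d ω).toNat : ℝ) / d - 1 / (Real.logb r (1 / p) - 1) = centered p X d ω / d := by
    rw [centered, nu, sub_div, div_right_comm, div_self hd0'.ne']
  rw [Real.dist_eq, e, abs_div, abs_of_pos hd0', div_lt_iff₀ hd0']
  refine hd.trans_lt ((mul_lt_mul_iff_left₀ hd0').2 ?_)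
  rw [div_lt_iff₀ hε] at hn
  rw [div_lt_iff₀ (by positivity)]
  nlinarith

/-- Along a sequence for which `ν_d` converges modulo `1`, the centered longest runs converge
weakly. -/
lemma IsBernoulliPercolation.tendstoInDistribution_centered [IsProbabilityMeasure μ]
    (hX : IsBernoulliPercolation μ r p X) (hr : 2 ≤ r) (hp0 : 0 < p) (hp : r * p < 1) {c : ℝ}
    (hc : Tendsto (fun n ↦ survival r p n / (r * p) ^ n) atTop (𝓝 c)) {ζ : Measure ℝ}
    [IsProbabilityMeasure ζ]
    (hζ : ∀ z : ℝ, ζ.real (Set.Iic z) =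
      Real.exp (-((1 - p) / (p * ((r : ℝ) - 1)) * c) * ((r : ℝ) * p) ^ z))
    {φ : ℕ → ℕ} (hφ : StrictMono φ) {a : ℝ}
    (ha : Tendsto (fun k ↦ (nu r p (φ k) : UnitAddCircle)) atTop (𝓝 (a : UnitAddCircle))) :
    TendstoInDistribution (fun k ↦ centered p X (φ k)) atTop
      (fun z : ℝ ↦ (⌊z + a⌋ : ℝ) - a) (fun _ ↦ μ) ζ where
  forall_aemeasurable k := (hX.measurable_centered (φ k)).aemeasurable
  aemeasurable_limit := by fun_prop
  tendsto := by
    have hx0 : (0 : ℝ) < r * p := by positivity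
    have hr' : (2 : ℝ) ≤ r := by exact_mod_cast hr
    have hcont : Continuous fun z : ℝ ↦
        Real.exp (-((1 - p) / (p * ((r : ℝ) - 1)) * c) * ((r : ℝ) * p) ^ z) :=
      Real.continuous_exp.comp ((Real.continuous_const_rpow hx0.ne').const_mul _)
    refine tendsto_of_tendsto_real_Iic (D := Set.range fun n : ℤ ↦ (n : ℝ) - a)
      (Set.countable_range _) fun y hy ↦ ?_
    have h := hX.tendsto_real_centered_le hr hp0 hp hc hφ.tendsto_atTop
      (tendsto_floor_add_sub_of_tendsto_unitAddCircle ha hy)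
    simp only [ProbabilityMeasure.coe_mk]
    rw [real_map_floor_Iic hcont hζ]
    -- The extra 1 in the exponent yields a factor rp, and rp C = Λ.
    have e : -((1 - p) / (p * ((r : ℝ) - 1)) * c) * ((r : ℝ) * p) ^ ((⌊y + a⌋ : ℝ) - a + 1) =
        -(c * r * (1 - p) / (r - 1) * (r * p) ^ ((⌊y + a⌋ : ℝ) - a)) := by
      have : (r : ℝ) - 1 ≠ 0 := by linarith
      rw [Real.rpow_add_one hx0.ne']
      field_simp
    rw [e]
    refine h.congr fun k ↦ ?_
    rw [map_measureReal_apply (hX.measurable_centered _) measurableSet_Iic]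
    rfl

/-- If the centered longest runs converge weakly along a sequence, then `ν_d` converges modulo
`1`. -/
lemma IsBernoulliPercolation.exists_tendsto_nu [IsProbabilityMeasure μ]
    (hX : IsBernoulliPercolation μ r p X) {φ : ℕ → ℕ} {L : Measure ℝ} [IsProbabilityMeasure L]
    (h : TendstoInDistribution (fun k ↦ centered p X (φ k)) atTop (fun y : ℝ ↦ y)
      (fun _ ↦ μ) L) :
    ∃ a : ℝ, Tendsto (fun k ↦ (nu r p (φ k) : UnitAddCircle)) atTop
      (𝓝 (a : UnitAddCircle)) := by
  -- The integer R_d disappears from exp(-2πi(R_d - ν_d)), so the integrand is almost surely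
  -- constant.
  have hchar : ∀ d, charFun (μ.map (centered p X d)) (-(2 * Real.pi)) =
      (AddCircle.toCircle (nu r p d : UnitAddCircle) : ℂ) := fun d ↦ by
    rw [charFun_apply_real, integral_map (hX.measurable_centered d).aemeasurable (by fun_prop)]
    have : ∀ ω, Complex.exp (((-(2 * Real.pi) : ℝ) : ℂ) * (centered p X d ω : ℂ) * Complex.I) =
        (AddCircle.toCircle (nu r p d : UnitAddCircle) : ℂ) := fun ω ↦ by
      rw [AddCircle.toCircle_apply_mk, Circle.coe_exp, Complex.exp_eq_exp_iff_exists_int]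
      refine ⟨-((R X d ω).toNat : ℤ), ?_⟩
      simp only [centered]
      push_cast
      ring
    rw [integral_congr_ae (.of_forall this)]
    simp
  have hlim := ProbabilityMeasure.tendsto_iff_tendsto_charFun.1 h.tendsto (-(2 * Real.pi))
  simp only [ProbabilityMeasure.coe_mk, hchar] at hlim
  have hnorm := hlim.norm
  simp only [Circle.norm_coe] at hnorm
  -- The limit has modulus 1, so it lies on the circle and can be pulled back to ℝ/ℤ.
  have h1 := tendsto_nhds_unique hnorm tendsto_const_nhds
  set w := charFun (L.map fun y : ℝ ↦ y) (-(2 * Real.pi))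
  let u : Circle := ⟨w, mem_sphere_zero_iff_norm.2 h1⟩
  have hu : Tendsto (fun k ↦ AddCircle.toCircle (nu r p (φ k) : UnitAddCircle)) atTop (𝓝 u) :=
    tendsto_subtype_rng.2 hlim
  let e := AddCircle.homeomorphCircle (T := 1) one_ne_zero
  obtain ⟨a, ha⟩ := QuotientAddGroup.mk_surjective (e.symm u)
  refine ⟨a, ?_⟩
  have := (e.symm.continuous.tendsto u).comp hu
  rw [← ha] at this
  refine this.congr fun k ↦ ?_
  rw [Function.comp_apply, ← AddCircle.homeomorphCircle_apply one_ne_zero]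
  exact e.symm_apply_apply _

end LongestRun

end TreePercolation

theorem theorem4 (r : ℕ) (hr : 2 ≤ r) (p : ℝ) (hp0 : 0 < p) (hp : p < 1 / (r : ℝ)) :
    -- the constant `C` and the law `ζ` of `Z` depend on `r` and `p` only
    ∃ (C : ℝ) (ζ : Measure ℝ) (_ : IsProbabilityMeasure ζ),
      0 < C ∧ (∀ z : ℝ, ζ.real (Set.Iic z) = Real.exp (-C * ((r : ℝ) * p) ^ z)) ∧
      ∀ {Ω : Type*} [MeasurableSpace Ω] (μ : Measure Ω) [IsProbabilityMeasure μ]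
        (X : TreePercolation.Node r → Ω → ℕ),
        TreePercolation.IsBernoulliPercolation μ r p X →
        -- the value of the constant
        Tendsto (fun h : ℕ => (1 - p) / (p * ((r : ℝ) - 1)) *
            (μ.real {ω | (h : ℕ∞) < TreePercolation.R X 0 ω} / ((r : ℝ) * p) ^ h))
          atTop (𝓝 C) ∧
        -- `R_d` is a random variable, finite almost surely
        (∀ d, Measurable (TreePercolation.R X d)) ∧
        (∀ᵐ ω ∂μ, ∀ d, TreePercolation.R X d ω < ⊤) ∧
        -- almost sure convergence
        (∀ᵐ ω ∂μ, Tendsto (fun d : ℕ => ((TreePercolation.R X d ω).toNat : ℝ) / (d : ℝ)) atTop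
          (𝓝 (1 / (Real.logb r (1 / p) - 1)))) ∧
        -- tightness
        IsTightMeasureSet (Set.range fun d : ℕ => μ.map (TreePercolation.centered p X d)) ∧
        -- weak convergence along subsequences
        ∀ φ : ℕ → ℕ, StrictMono φ →
          ((∃ (L : Measure ℝ) (_ : IsProbabilityMeasure L),
              TendstoInDistribution (fun k => TreePercolation.centered p X (φ k)) atTop
                (fun y : ℝ => y) (fun _ => μ) L) ↔
            ∃ a : ℝ, Tendsto (fun k => (TreePercolation.nu r p (φ k) : UnitAddCircle)) atTop
              (𝓝 (a : UnitAddCircle))) ∧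
          (∀ a : ℝ,
            Tendsto (fun k => (TreePercolation.nu r p (φ k) : UnitAddCircle)) atTop
              (𝓝 (a : UnitAddCircle)) →
            TendstoInDistribution (fun k => TreePercolation.centered p X (φ k)) atTop
              (fun z : ℝ => (⌊z + a⌋ : ℝ) - a) (fun _ => μ) ζ) ∧
          (∀ a : ℝ,
            Tendsto (fun k => Int.fract (TreePercolation.nu r p (φ k))) atTop (𝓝 a) →
            TendstoInDistribution (fun k => TreePercolation.centered p X (φ k)) atTop
              (fun z : ℝ => (⌊z + a⌋ : ℝ) - a) (fun _ => μ) ζ)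
 := by
  have hr' : (2 : ℝ) ≤ r := by exact_mod_cast hr
  have hrp : (r : ℝ) * p < 1 := by
    rwa [lt_div_iff₀ (by linarith), mul_comm] at hp
  have hx0 : (0 : ℝ) < r * p := by positivity
  obtain ⟨c, hc0, hc⟩ := TreePercolation.exists_tendsto_survival hr hp0 hrp
  have hC : 0 < (1 - p) / (p * ((r : ℝ) - 1)) * c :=
    mul_pos (div_pos (by nlinarith) (mul_pos hp0 (by linarith))) hc0
  obtain ⟨ζ, hζp, hζ⟩ := TreePercolation.exists_measure_Iic_eq_exp_neg_mul_rpow hx0 hrp hC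
  -- C is built from the limit c of the deterministic `survival` sequence, so it is chosen before
  -- any probability space.
  refine ⟨_, ζ, hζp, hC, hζ, fun {Ω} _ μ _ X hX ↦ ⟨?_, hX.measurable_R,
    hX.ae_R_lt_top hr hp0 hrp, hX.ae_tendsto_R_div hr hp0 hrp,
    hX.isTightMeasureSet_centered hr hp0 hrp, fun φ hφ ↦ ?_⟩⟩
  · simp only [hX.real_lt_R_zero]
    exact hc.const_mul _
  · have hweak := fun (a : ℝ) (ha : Tendsto (fun k ↦ (TreePercolation.nu r p (φ k) : UnitAddCircle))
      atTop (𝓝 (a : UnitAddCircle))) ↦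
        hX.tendstoInDistribution_centered hr hp0 hrp hc hζ hφ ha
    refine ⟨⟨?_, ?_⟩, hweak, fun a ha ↦ hweak a ?_⟩
    · rintro ⟨L, _, hL⟩
      exact hX.exists_tendsto_nu hL
    · rintro ⟨a, ha⟩
      have h := hweak a ha
      have hL := Measure.isProbabilityMeasure_map h.aemeasurable_limit
      exact ⟨_, hL, h.forall_aemeasurable, aemeasurable_id', by
        simpa only [Measure.map_id'] using h.tendsto⟩
    · have := ((AddCircle.continuous_mk' (1 : ℝ)).tendsto a).comp ha
      refine this.congr fun k ↦ ?_
      exact AddCircle.coe_fract _
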